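/- Theorem 5 (Sliding-Window Robust MOSS). Consider a bandit problem with $K\ge 1$ arms and horizon $T$. An environment assigns to each slot $t\in\{1,\dots,T\}$ and each arm $k\in\{1,\dots,K\}$ a probability distribution on $\mathbb{R}$; the rewards $X_t^k$ with these distributions are independent, with means $\mu_t^k=\mathbb{E}[X_t^k]$, and are heavy-tailed in the sense that $\mathbb{E}[(X_t^k)^2]\le 1$ for all $t,k$. For $V_T>0$ let $\mathcal{E}(V_T,T,K)$ be the set of such environments with $$\sum_{t=1}^{T-1}\max_{k}\bigl|\mu_{t+1}^k-\mu_t^k\bigr|\le V_T .$$ A policy chooses the arm $\varphi_t$ from the past observations $(\varphi_s,X_s^{\varphi_s})_{s<t}$, and its regret is $R_T=\sum_{t=1}^T\max_k\mu_t^k-\mathbb{E}\bigl[\sum_{t=1}^T X_t^{\varphi_t}\bigr]$. Let $a>1$, $\zeta>0$, $\ln_+(x)=\max(\ln x,1)$, $\psi(x)=(1+1/x)\ln(1+x)-1$, $h(m)=a^{\lfloor\log_a m\rfloor+1}$, and for a window length $\tau$ and $m\ge 1$ let $$B_m=\sqrt{\frac{h(m)}{\ln_+\!\bigl(\tau/(K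 h(m))\bigr)}},\qquad c_m=\sqrt{\frac{\ln_+\!\bigl(\tau/(K m)\bigr)}{m}},\qquad \operatorname{sat}(x,B)=\operatorname{sign}(x)\min\{|x|,B\}.$$ Sliding-Window Robust MOSS (SW-RMOSS) selects each arm once during the first $K$ slots, in any order. At every slot $t>K$ it selects an arm $k$ that maximizes the index $$g_t^k=\frac{1}{n_k(t)}\sum_{s\in\mathcal{W}_t,\ \varphi_s=k}\operatorname{sat}\bigl(X_s^{\varphi_s},B_{n_k(t)}\bigr)+(1+\zeta)\,c_{n_k(t)},$$ with ties broken by any (measurable) rule, where $\mathcal{W}_t=\{\max(1,t-\tau),\dots,t-1\}$ and $n_k(t)=\#\{s\in\mathcal{W}_t:\varphi_s=k\}$; the index is $+\infty$ if $n_k(t)=0$. If $\psi(2\zeta/a)\ge 2a/\zeta$, then there is a constant $C>0$, depending only on $a$ and $\zeta$, such that for all $K\ge 1$, $T$ and $V_T>0$ for which the window length $\tau=\bigl\lceil K^{1/3}(T/V_T)^{2/3}\bigr\rceil$ satisfies $\tau\le T$, the worst-case regret of SW-RMOSS with this window length satisfies $$\sup_{\mathcal{E}(V_T,T,K)}R_T^{\text{SW-RMOSS}}\le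 C\,(K V_T)^{1/3}\,T^{2/3}.$$ -/

import Mathlib

open MeasureTheory

noncomputable section

namespace SWRMOSS

/-! ### Environments

Time slots are indexed by `Fin T` and arms by `Fin K`; slot `t` of the usual numbering
`1, …, T` is the element `t - 1` of `Fin T`. -/

/-- A (nonstationary) environment: a reward distribution for every slot and every arm. -/
abbrev Environment (K T : ℕ) : Type := Fin T → Fin K → ProbabilityMeasure ℝ

namespace Environment

variable {K T : ℕ}

/-- Mean reward of arm `k` at slot `t`. -/
def mean (ν : Environment K T) (t : Fin T) (k : Fin K) : ℝ :=
  ∫ x, x ∂(ν t k : Measure ℝ)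

/-- Largest mean reward at slot `t`. -/
def bestMean (ν : Environment K T) (t : Fin T) : ℝ :=
  ⨆ k : Fin K, ν.mean t k

/-- Total variation: the sum over consecutive slots of the largest change of a mean reward. -/
def variation (ν : Environment K T) : ℝ :=
  ∑ t : Fin T, if h : (t : ℕ) + 1 < T then
    ⨆ k : Fin K, |ν.mean ⟨(t : ℕ) + 1, h⟩ k - ν.mean t k| else 0

/-- Heavy-tailed rewards: every reward has second moment at most `1`. The second moment is
taken in `[0, ∞]`, so that its finiteness is part of the condition. -/
def HeavyTailed (ν : Environment K T) : Prop :=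
  ∀ t k, ∫⁻ x, ENNReal.ofReal (x ^ 2) ∂(ν t k : Measure ℝ) ≤ 1

/-- Joint law of the table of rewards `(X_t^k)`: all entries are independent, and the entry
`(t, k)` has law `ν t k`. -/
def rewardLaw (ν : Environment K T) : Measure (Fin T → Fin K → ℝ) :=
  Measure.pi fun t => Measure.pi fun k => (ν t k : Measure ℝ)

/-- The heavy-tailed environments whose total variation is within the budget `V`. -/
def withinBudget (K T : ℕ) (V : ℝ) : Set (Environment K T) :=
  {ν | ν.HeavyTailed ∧ ν.variation ≤ V}

end Environment

/-! ### Policies and regret -/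

/-- A (deterministic) policy chooses the arm of slot `t` from the arms selected and the rewards
observed in the `t` earlier slots. -/
abbrev Policy (K : ℕ) : Type := (t : ℕ) → (Fin t → Fin K × ℝ) → Fin K

namespace Policy

variable {K T : ℕ}

/-- The pairs (arm selected, reward received) of the first `t` slots, when `π` is played against
the table of rewards `x`. -/
def history (π : Policy K) (x : Fin T → Fin K → ℝ) :
    (t : ℕ) → t ≤ T → (Fin t → Fin K × ℝ)
  | 0, _ => Fin.elim0
  | t + 1, h =>
    let H := history π x t (Nat.le_of_succ_le h)
    Fin.snoc (α := fun _ => Fin K × ℝ) H (π t H, x ⟨t, h⟩ (π t H))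

/-- The arm selected by `π` at slot `t`, when played against the table of rewards `x`. -/
def arm (π : Policy K) (x : Fin T → Fin K → ℝ) (t : Fin T) : Fin K :=
  π t (π.history x t t.isLt.le)

/-- Regret of `π`: the sum of the largest mean rewards minus the expected cumulative reward. -/
def regret (π : Policy K) (ν : Environment K T) : ℝ :=
  (∑ t : Fin T, ν.bestMean t) - ∫ x, ∑ t : Fin T, x t (π.arm x t) ∂ν.rewardLaw

/-- Worst-case regret of `π` over the heavy-tailed environments with variation budget `V`. -/
def worstCaseRegret (π : Policy K) (T : ℕ) (V : ℝ) : EReal :=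
  ⨆ ν ∈ Environment.withinBudget K T V, (π.regret ν : EReal)

end Policy

/-! ### Sliding-Window Robust MOSS -/

/-- `ln₊ x = max (ln x) 1`. -/
def lnPlus (x : ℝ) : ℝ := max (Real.log x) 1

/-- `ψ x = (1 + 1 / x) ln (1 + x) - 1`. -/
def psi (x : ℝ) : ℝ := (1 + 1 / x) * Real.log (1 + x) - 1

/-- `h m = a ^ (⌊log_a m⌋ + 1)`, for `m ≥ 1`. -/
def gridUp (a : ℝ) (m : ℕ) : ℝ := a ^ (⌊Real.logb a m⌋₊ + 1)

/-- Saturation limit for `m` samples, window length `τ` and `K` arms. -/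
def satLimit (a : ℝ) (K τ m : ℕ) : ℝ :=
  Real.sqrt (gridUp a m / lnPlus ((τ : ℝ) / (K * gridUp a m)))

/-- The value `x` saturated at level `B`. -/
def sat (x B : ℝ) : ℝ := Real.sign x * min |x| B

/-- Confidence radius for `m` samples, window length `τ` and `K` arms. -/
def radius (K τ m : ℕ) : ℝ :=
  Real.sqrt (lnPlus ((τ : ℝ) / (K * m)) / m)

section Index

variable {K t : ℕ}

/-- The slots among the last `τ` ones before slot `t` in which arm `k` was selected. -/
def windowSlots (τ : ℕ) (H : Fin t → Fin K × ℝ) (k : Fin K) : Finset (Fin t) :=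
  {s | t ≤ (s : ℕ) + τ ∧ (H s).1 = k}

/-- Saturated mean of the rewards of arm `k` within the window. -/
def satMean (a : ℝ) (τ : ℕ) (H : Fin t → Fin K × ℝ) (k : Fin K) : ℝ :=
  1 / ((windowSlots τ H k).card : ℝ) *
    ∑ s ∈ windowSlots τ H k, sat (H s).2 (satLimit a K τ (windowSlots τ H k).card)

/-- Upper confidence index of arm `k`; it is `+∞` if the arm has no sample in the window. -/
def ucbIndex (a ζ : ℝ) (τ : ℕ) (H : Fin t → Fin K × ℝ) (k : Fin K) : EReal :=
  if (windowSlots τ H k).card = 0 then ⊤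
  else ((satMean a τ H k + (1 + ζ) * radius K τ (windowSlots τ H k).card : ℝ) : EReal)

end Index

/-- `π` is Sliding-Window Robust MOSS with parameters `a`, `ζ` and window length `τ`: in the
first `K` slots it selects each arm once, and afterwards it selects an arm of maximal index.
The order of the first `K` selections and the way ties are broken are arbitrary. -/
structure IsSWRMOSS {K : ℕ} (a ζ : ℝ) (τ : ℕ) (π : Policy K) : Prop where
  measurable : ∀ t, Measurable (π t)
  initial : ∀ t < K, ∀ (H : Fin t → Fin K × ℝ) (s : Fin t), (H s).1 ≠ π t H
  maximal : ∀ t, K ≤ t → ∀ (H : Fin t → Fin K × ℝ) (k : Fin K),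
    ucbIndex a ζ τ H k ≤ ucbIndex a ζ τ H (π t H)

/-- The window length `⌈K ^ (1/3) * (T / V) ^ (2/3)⌉`. -/
def windowLength (K T : ℕ) (V : ℝ) : ℕ :=
  ⌈(K : ℝ) ^ (1 / 3 : ℝ) * ((T : ℝ) / V) ^ (2 / 3 : ℝ)⌉₊

end SWRMOSS

end

/-!
Compare a slot's best arm `k` with the arm `j` that is selected. Since `j` has the larger index, the
loss of the slot is at most the drift of the means inside the window, plus the confidence radius of
`j`, plus the amount by which the index of `k` underestimates, plus the amount by which the
saturated mean of `j` overestimates. All sample sizes are grouped into levels `m < a ^ l` that share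
one saturation limit, so that within a level the noise is a sum of bounded martingale differences.

* Underestimation is controlled by exponential moments, as in Bennett's inequality; the assumption
  on `psi` is what makes the contributions of the levels summable.
* Overestimation is controlled by fourth moments. Cutting the selections of an arm into blocks of
  the length of a level, Doob's maximal inequality on each block covers all the windows at once.

With `ρ ^ 4 = τ / K`, both sums over the levels are of order `1 / ρ ^ 2 = √(K / τ)` per slot. The
regret is thus of order `τ V + T √(K / τ)`, and the window length balances the two terms.
-/

open MeasureTheory ProbabilityTheory

noncomputable section

namespace SWRMOSS

/-! ### Bounded martingale differences -/

section Noise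

variable {Ω : Type*}

/-- The algebra of bounded `m`-measurable functions: every integrand of the martingale part lives
here, so that integrability is a matter of closure properties. -/
def boundedMeasurable (m : MeasurableSpace Ω) : Subalgebra ℝ (Ω → ℝ) where
  carrier := {f | Measurable[m] f ∧ ∃ c, ∀ ω, |f ω| ≤ c}
  mul_mem' := by
    rintro f g ⟨hf, c, hc⟩ ⟨hg, d, hd⟩
    refine ⟨hf.mul hg, c * d, fun ω => ?_⟩
    rw [Pi.mul_apply, abs_mul]
    exact mul_le_mul (hc ω) (hd ω) (abs_nonneg _) ((abs_nonneg _).trans (hc ω))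
  add_mem' := by
    rintro f g ⟨hf, c, hc⟩ ⟨hg, d, hd⟩
    exact ⟨hf.add hg, c + d, fun ω => (abs_add_le _ _).trans (add_le_add (hc ω) (hd ω))⟩
  algebraMap_mem' r := ⟨measurable_const, |r|, fun _ => le_rfl⟩

variable {m mΩ : MeasurableSpace Ω} {P : Measure Ω} {f g : Ω → ℝ}

theorem const_mem_boundedMeasurable (c : ℝ) : (fun _ => c) ∈ boundedMeasurable m :=
  (boundedMeasurable m).algebraMap_mem c

theorem boundedMeasurable_mono {m' : MeasurableSpace Ω} (h : m ≤ m') :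
    boundedMeasurable m ≤ boundedMeasurable m' :=
  fun _ hf => ⟨hf.1.mono h le_rfl, hf.2⟩

theorem comp_mem_boundedMeasurable {φ : ℝ → ℝ} (hφ : Continuous φ)
    (hf : f ∈ boundedMeasurable m) : (fun ω => φ (f ω)) ∈ boundedMeasurable m := by
  obtain ⟨hm, c, hc⟩ := hf
  obtain ⟨d, hd⟩ := isCompact_Icc.exists_bound_of_continuousOn (s := Set.Icc (-c) c) hφ.continuousOn
  exact ⟨hφ.measurable.comp hm, d, fun ω => hd _ (abs_le.1 (hc ω))⟩

theorem max_mem_boundedMeasurable (hf : f ∈ boundedMeasurable m) (hg : g ∈ boundedMeasurable m) :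
    (fun ω => max (f ω) (g ω)) ∈ boundedMeasurable m := by
  obtain ⟨hfm, c, hc⟩ := hf
  obtain ⟨hgm, d, hd⟩ := hg
  exact ⟨hfm.max hgm, max c d, fun ω => abs_max_le_max_abs_abs.trans (max_le_max (hc ω) (hd ω))⟩

theorem sign_mem_boundedMeasurable (hf : f ∈ boundedMeasurable m) :
    (fun ω => Real.sign (f ω)) ∈ boundedMeasurable m := by
  refine ⟨Measurable.ite (hf.1 measurableSet_Iio) measurable_const
    (Measurable.ite (hf.1 measurableSet_Ioi) measurable_const measurable_const), 1, fun ω => ?_⟩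
  rcases Real.sign_apply_eq (f ω) with h | h | h <;> simp [h]

theorem indicator_mem_boundedMeasurable (hf : f ∈ boundedMeasurable m) {s : Set Ω}
    (hs : MeasurableSet[m] s) : s.indicator f ∈ boundedMeasurable m := by
  obtain ⟨hm, c, hc⟩ := hf
  refine ⟨hm.indicator hs, c, fun ω => ?_⟩
  by_cases h : ω ∈ s
  · simpa only [Set.indicator_of_mem h] using hc ω
  · simpa only [Set.indicator_of_notMem h, abs_zero] using (abs_nonneg _).trans (hc ω)

theorem integrable_of_mem_boundedMeasurable [IsFiniteMeasure P] (hm : m ≤ mΩ)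
    (hf : f ∈ boundedMeasurable m) : Integrable f P := by
  obtain ⟨hfm, c, hc⟩ := hf
  exact .of_bound (hfm.mono hm le_rfl).aestronglyMeasurable c (ae_of_all _ hc)

theorem condExp_mul_of_mem_boundedMeasurable [IsFiniteMeasure P] (hm : m ≤ mΩ)
    (hf : f ∈ boundedMeasurable m) (hg : Integrable g P) : P[f * g | m] =ᵐ[P] f * P[g | m] := by
  obtain ⟨hfm, c, hc⟩ := hf
  exact condExp_stronglyMeasurable_mul_of_bound hm hfm.stronglyMeasurable hg c (ae_of_all _ hc)

/-- `Y` is a sequence of martingale differences for `ℱ`, bounded by `b`, with the predictable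
sequence `V` as variance proxy. -/
structure IsNoise (P : Measure Ω) (ℱ : Filtration ℕ mΩ) (b : ℝ) (V Y : ℕ → Ω → ℝ) : Prop where
  variance_mem : ∀ s, V s ∈ boundedMeasurable (ℱ s)
  variance_nonneg : ∀ s ω, 0 ≤ V s ω
  measurable : ∀ s, Measurable[ℱ (s + 1)] (Y s)
  abs_le : ∀ s ω, |Y s ω| ≤ b
  condExp_eq_zero : ∀ s, P[Y s | ℱ s] =ᵐ[P] 0
  condExp_sq_le : ∀ s, P[Y s ^ 2 | ℱ s] ≤ᵐ[P] V s

namespace IsNoise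

variable {ℱ : Filtration ℕ mΩ} {b : ℝ} {V Y : ℕ → Ω → ℝ}

theorem mem_boundedMeasurable (h : IsNoise P ℱ b V Y) {s t : ℕ} (hst : s < t) :
    Y s ∈ boundedMeasurable (ℱ t) :=
  boundedMeasurable_mono (ℱ.mono hst) ⟨h.measurable s, b, h.abs_le s⟩

theorem variance_mem_of_le (h : IsNoise P ℱ b V Y) {s t : ℕ} (hst : s ≤ t) :
    V s ∈ boundedMeasurable (ℱ t) :=
  boundedMeasurable_mono (ℱ.mono hst) (h.variance_mem s)

theorem sum_mem_boundedMeasurable (h : IsNoise P ℱ b V Y) (s t : ℕ) :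
    (fun ω => ∑ r ∈ Finset.Ico s t, Y r ω) ∈ boundedMeasurable (ℱ t) := by
  rw [← Finset.sum_fn]
  exact sum_mem fun r hr => h.mem_boundedMeasurable (Finset.mem_Ico.1 hr).2

theorem sum_variance_mem_boundedMeasurable (h : IsNoise P ℱ b V Y) (s t : ℕ) :
    (fun ω => ∑ r ∈ Finset.Ico s t, V r ω) ∈ boundedMeasurable (ℱ t) := by
  rw [← Finset.sum_fn]
  exact sum_mem fun r hr => h.variance_mem_of_le (Finset.mem_Ico.1 hr).2.le

theorem integral_quadratic_le [IsFiniteMeasure P] (h : IsNoise P ℱ b V Y) (s : ℕ) {p q r : Ω → ℝ}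
    (hp : p ∈ boundedMeasurable (ℱ s)) (hq : q ∈ boundedMeasurable (ℱ s))
    (hr : r ∈ boundedMeasurable (ℱ s)) (hr0 : ∀ ω, 0 ≤ r ω) :
    ∫ ω, p ω + q ω * Y s ω + r ω * Y s ω ^ 2 ∂P ≤ ∫ ω, p ω + r ω * V s ω ∂P := by
  have hle := ℱ.le s
  have hint {f : Ω → ℝ} (hf : f ∈ boundedMeasurable (ℱ (s + 1))) : Integrable f P :=
    integrable_of_mem_boundedMeasurable (ℱ.le _) hf
  have hlift := boundedMeasurable_mono (ℱ.mono s.le_succ)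
  have hY := h.mem_boundedMeasurable s.lt_succ_self
  have hqY : ∫ ω, q ω * Y s ω ∂P = 0 := by
    rw [← integral_condExp hle]
    refine (integral_congr_ae ?_).trans (integral_zero Ω ℝ)
    filter_upwards [condExp_mul_of_mem_boundedMeasurable hle hq (hint hY), h.condExp_eq_zero s]
      with ω h1 h2
    exact h1.trans (by rw [Pi.mul_apply, h2, Pi.zero_apply, mul_zero])
  have hrY : ∫ ω, r ω * Y s ω ^ 2 ∂P ≤ ∫ ω, r ω * V s ω ∂P := by
    rw [← integral_condExp hle]
    refine integral_mono_ae integrable_condExp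
      (integrable_of_mem_boundedMeasurable hle (mul_mem hr (h.variance_mem s))) ?_
    filter_upwards [condExp_mul_of_mem_boundedMeasurable hle hr (hint (pow_mem hY 2)),
      h.condExp_sq_le s] with ω h1 h2
    exact h1.le.trans (mul_le_mul_of_nonneg_left h2 (hr0 ω))
  have hp' := hint (hlift hp)
  have hqi : Integrable (fun ω => q ω * Y s ω) P := hint (mul_mem (hlift hq) hY)
  have hpq : Integrable (fun ω => p ω + q ω * Y s ω) P := hp'.add hqi
  have hri : Integrable (fun ω => r ω * Y s ω ^ 2) P := hint (mul_mem (hlift hr) (pow_mem hY 2))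
  have hVi : Integrable (fun ω => r ω * V s ω) P :=
    hint (mul_mem (hlift hr) (hlift (h.variance_mem s)))
  rw [integral_add hpq hri, integral_add hp' hqi, integral_add hp' hVi, hqY]
  linarith

theorem integral_le_of_le_quadratic [IsFiniteMeasure P] (h : IsNoise P ℱ b V Y) (s : ℕ)
    {F G p q r : Ω → ℝ} (hF : F ∈ boundedMeasurable (ℱ (s + 1))) (hG : G ∈ boundedMeasurable (ℱ s))
    (hp : p ∈ boundedMeasurable (ℱ s)) (hq : q ∈ boundedMeasurable (ℱ s))
    (hr : r ∈ boundedMeasurable (ℱ s)) (hr0 : ∀ ω, 0 ≤ r ω)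
    (hFle : ∀ ω, F ω ≤ p ω + q ω * Y s ω + r ω * Y s ω ^ 2)
    (hleG : ∀ ω, p ω + r ω * V s ω ≤ G ω) : ∫ ω, F ω ∂P ≤ ∫ ω, G ω ∂P := by
  have hY := h.mem_boundedMeasurable s.lt_succ_self
  have hlift := boundedMeasurable_mono (ℱ.mono s.le_succ)
  calc ∫ ω, F ω ∂P ≤ ∫ ω, p ω + q ω * Y s ω + r ω * Y s ω ^ 2 ∂P :=
        integral_mono (integrable_of_mem_boundedMeasurable (ℱ.le _) hF)
          (integrable_of_mem_boundedMeasurable (ℱ.le _) (add_mem (add_mem (hlift hp)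
            (mul_mem (hlift hq) hY)) (mul_mem (hlift hr) (pow_mem hY 2)))) hFle
    _ ≤ ∫ ω, p ω + r ω * V s ω ∂P := h.integral_quadratic_le s hp hq hr hr0
    _ ≤ ∫ ω, G ω ∂P :=
        integral_mono (integrable_of_mem_boundedMeasurable (ℱ.le _)
          (add_mem hp (mul_mem hr (h.variance_mem s))))
          (integrable_of_mem_boundedMeasurable (ℱ.le _) hG) hleG

end IsNoise

end Noise

theorem exp_sub_one_sub_mul_sq_le_of_nonpos {z c : ℝ} (hc : 0 ≤ c) (hz : z ≤ 0) :
    (Real.exp z - 1 - z) * c ^ 2 ≤ (Real.exp c - 1 - c) * z ^ 2 := by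
  have hexp : Real.exp z ≤ 1 + z + z ^ 2 / 2 := by
    have h1 := Real.quadratic_le_exp_of_nonneg (neg_nonneg.2 hz)
    have h2 : (0 : ℝ) ≤ 1 + z + z ^ 2 / 2 := by nlinarith [sq_nonneg (z + 1)]
    have h3 : 1 ≤ (1 + z + z ^ 2 / 2) * (1 + -z + (-z) ^ 2 / 2) := by
      nlinarith [sq_nonneg (z ^ 2)]
    calc Real.exp z ≤ (1 + z + z ^ 2 / 2) * (1 + -z + (-z) ^ 2 / 2) * Real.exp z :=
          le_mul_of_one_le_left (Real.exp_pos z).le h3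
      _ ≤ (1 + z + z ^ 2 / 2) * Real.exp (-z) * Real.exp z := by gcongr
      _ = 1 + z + z ^ 2 / 2 := by rw [mul_assoc, ← Real.exp_add, neg_add_cancel, Real.exp_zero,
        mul_one]
  have hquad := Real.quadratic_le_exp_of_nonneg hc
  nlinarith [mul_le_mul_of_nonneg_right hexp (sq_nonneg c),
    mul_le_mul_of_nonneg_right hquad (sq_nonneg z)]

theorem hasSum_exp_sub_one_sub (w : ℝ) :
    HasSum (fun n : ℕ => w ^ (n + 2) / (n + 2).factorial) (Real.exp w - 1 - w) := by
  have h : HasSum (fun n : ℕ => w ^ n / n.factorial) (Real.exp w) := by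
    rw [Real.exp_eq_exp_ℝ]
    exact NormedSpace.expSeries_div_hasSum_exp w
  simpa [Finset.sum_range_succ, sub_sub] using (hasSum_nat_add_iff' 2).2 h

theorem exp_sub_one_sub_mul_sq_le {z c : ℝ} (hc : 0 ≤ c) (hz : z ≤ c) :
    (Real.exp z - 1 - z) * c ^ 2 ≤ (Real.exp c - 1 - c) * z ^ 2 := by
  rcases le_or_gt z 0 with hz0 | hz0
  · exact exp_sub_one_sub_mul_sq_le_of_nonpos hc hz0
  refine hasSum_le (fun n => ?_) ((hasSum_exp_sub_one_sub z).mul_right (c ^ 2))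
    ((hasSum_exp_sub_one_sub c).mul_right (z ^ 2))
  rw [div_mul_eq_mul_div, div_mul_eq_mul_div]
  gcongr ?_ / _
  calc z ^ (n + 2) * c ^ 2 = z ^ n * (z ^ 2 * c ^ 2) := by ring
    _ ≤ c ^ n * (z ^ 2 * c ^ 2) := by gcongr
    _ = c ^ (n + 2) * z ^ 2 := by ring

/-- The exponential rate of Bennett's inequality at parameter `l`, for increments bounded by
`b`. -/
def expRate (b l : ℝ) : ℝ := (Real.exp (b * l) - 1 - b * l) / b ^ 2

theorem expRate_nonneg (b l : ℝ) : 0 ≤ expRate b l :=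
  div_nonneg (by linarith [Real.add_one_le_exp (b * l)]) (sq_nonneg b)

theorem exp_neg_mul_le {b l y : ℝ} (hb : 0 < b) (hl : 0 < l) (hy : |y| ≤ b) :
    Real.exp (-l * y) ≤ 1 - l * y + expRate b l * y ^ 2 := by
  have hz : -l * y ≤ b * l := by nlinarith [neg_le_of_abs_le hy]
  have h := exp_sub_one_sub_mul_sq_le (by positivity) hz
  have h' : Real.exp (-l * y) - 1 - -l * y ≤ expRate b l * y ^ 2 := by
    rw [expRate, div_mul_eq_mul_div, le_div_iff₀ (by positivity)]
    refine le_of_mul_le_mul_right ?_ (sq_pos_of_pos hl)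
    linarith
  linarith

theorem add_pow_four_le {M y b : ℝ} (hy : |y| ≤ b) :
    (M + y) ^ 4 ≤ M ^ 4 + 4 * M ^ 3 * y + (10 * M ^ 2 + 2 * b ^ 2) * y ^ 2 := by
  have hy2 : y ^ 2 ≤ b ^ 2 := sq_le_sq' (neg_le_of_abs_le hy) (le_of_abs_le hy)
  nlinarith [mul_nonneg (sq_nonneg (2 * M - y)) (sq_nonneg y),
    mul_le_mul_of_nonneg_right hy2 (sq_nonneg y)]

theorem abs_add_sign_mul_le (M y : ℝ) : |M| + Real.sign M * y ≤ |M + y| := by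
  rcases lt_trichotomy M 0 with h | rfl | h
  · rw [Real.sign_of_neg h, abs_of_neg h]
    linarith [neg_le_abs (M + y)]
  · simp
  · rw [Real.sign_of_pos h, abs_of_pos h]
    linarith [le_abs_self (M + y)]

theorem three_mul_max_pow_sub_le {O v : ℝ} (hO : 0 ≤ O) :
    3 * max O v ^ 4 - 4 * v * max O v ^ 3 ≤ 3 * O ^ 4 - 4 * v * O ^ 3 := by
  rcases le_total v O with h | h
  · rw [max_eq_left h]
  · rw [max_eq_right h]
    have : 0 ≤ (v - O) ^ 2 * (v ^ 2 + 2 * (v * O) + 3 * O ^ 2) := by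
      have := mul_nonneg (hO.trans h) hO
      positivity
    nlinarith

theorem pow_four_le_doob {O u : ℝ} (hO : 0 ≤ O) (hu : 0 ≤ u) :
    O ^ 4 ≤ 27 / 8 * u ^ 4 + (3 * O ^ 4 - 4 * u * O ^ 3) := by
  have : 0 ≤ (u - 2 / 3 * O) ^ 2 * (u ^ 2 + 4 / 3 * (u * O) + 4 / 3 * O ^ 2) := by positivity
  nlinarith

namespace IsNoise

variable {Ω : Type*} {mΩ : MeasurableSpace Ω} {P : Measure Ω} {ℱ : Filtration ℕ mΩ} {b : ℝ}
  {V Y : ℕ → Ω → ℝ}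

theorem exp_mem_boundedMeasurable (h : IsNoise P ℱ b V Y) (l g : ℝ) (s t : ℕ) :
    (fun ω => Real.exp (-l * ∑ r ∈ Finset.Ico s t, Y r ω - g * ∑ r ∈ Finset.Ico s t, V r ω))
      ∈ boundedMeasurable (ℱ t) :=
  comp_mem_boundedMeasurable Real.continuous_exp
    (sub_mem (mul_mem (const_mem_boundedMeasurable (-l)) (h.sum_mem_boundedMeasurable s t))
      (mul_mem (const_mem_boundedMeasurable g) (h.sum_variance_mem_boundedMeasurable s t)))

theorem integral_exp_succ_le [IsFiniteMeasure P] (h : IsNoise P ℱ b V Y) (hb : 0 < b) {l : ℝ}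
    (hl : 0 < l) {s t : ℕ} (hst : s ≤ t) :
    ∫ ω, Real.exp (-l * ∑ r ∈ Finset.Ico s (t + 1), Y r ω
        - expRate b l * ∑ r ∈ Finset.Ico s (t + 1), V r ω) ∂P
      ≤ ∫ ω, Real.exp (-l * ∑ r ∈ Finset.Ico s t, Y r ω
        - expRate b l * ∑ r ∈ Finset.Ico s t, V r ω) ∂P := by
  set g := expRate b l
  set W : Ω → ℝ := fun ω =>
    Real.exp (-l * ∑ r ∈ Finset.Ico s t, Y r ω - g * ∑ r ∈ Finset.Ico s t, V r ω)
  set p : Ω → ℝ := fun ω => W ω * Real.exp (-g * V t ω)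
  have hW : W ∈ boundedMeasurable (ℱ t) := h.exp_mem_boundedMeasurable l g s t
  have hp : p ∈ boundedMeasurable (ℱ t) := mul_mem hW (comp_mem_boundedMeasurable
    Real.continuous_exp (mul_mem (const_mem_boundedMeasurable (-g)) (h.variance_mem t)))
  have hp0 (ω : Ω) : 0 ≤ p ω := (mul_pos (Real.exp_pos _) (Real.exp_pos _)).le
  refine h.integral_le_of_le_quadratic t (h.exp_mem_boundedMeasurable l g s (t + 1)) hW hp
    (q := fun ω => -l * p ω) (r := fun ω => g * p ω) (mul_mem (const_mem_boundedMeasurable _) hp)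
    (mul_mem (const_mem_boundedMeasurable _) hp)
    (fun ω => mul_nonneg (expRate_nonneg b l) (hp0 ω)) (fun ω => ?_) fun ω => ?_
  · simp only [Finset.sum_Ico_succ_top hst]
    calc _ = p ω * Real.exp (-l * Y t ω) := by
          simp only [p, W, ← Real.exp_add]; ring_nf
      _ ≤ p ω * (1 - l * Y t ω + g * Y t ω ^ 2) :=
          mul_le_mul_of_nonneg_left (exp_neg_mul_le hb hl (h.abs_le t ω)) (hp0 ω)
      _ = _ := by ring
  · have hexp : Real.exp (-g * V t ω) * (1 + g * V t ω) ≤ 1 := by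
      rw [neg_mul, Real.exp_neg, inv_mul_le_one₀ (Real.exp_pos _)]
      linarith [Real.add_one_le_exp (g * V t ω)]
    calc _ = W ω * (Real.exp (-g * V t ω) * (1 + g * V t ω)) := by ring
      _ ≤ W ω := mul_le_of_le_one_right (Real.exp_pos _).le hexp

theorem integral_exp_le_one [IsProbabilityMeasure P] (h : IsNoise P ℱ b V Y) (hb : 0 < b) {l : ℝ}
    (hl : 0 < l) {s t : ℕ} (hst : s ≤ t) :
    ∫ ω, Real.exp (-l * ∑ r ∈ Finset.Ico s t, Y r ω
      - expRate b l * ∑ r ∈ Finset.Ico s t, V r ω) ∂P ≤ 1 := by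
  induction t, hst using Nat.le_induction with
  | base => simp
  | succ t hst ih => exact (h.integral_exp_succ_le hb hl hst).trans ih

theorem sum_range_mem_boundedMeasurable (h : IsNoise P ℱ b V Y) (n : ℕ) :
    (fun ω => ∑ s ∈ Finset.range n, Y s ω) ∈ boundedMeasurable (ℱ n) := by
  simpa only [Finset.range_eq_Ico] using h.sum_mem_boundedMeasurable 0 n

theorem sum_range_variance_mem_boundedMeasurable (h : IsNoise P ℱ b V Y) (n : ℕ) :
    (fun ω => ∑ s ∈ Finset.range n, V s ω) ∈ boundedMeasurable (ℱ n) := by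
  simpa only [Finset.range_eq_Ico] using h.sum_variance_mem_boundedMeasurable 0 n

theorem integral_pow_four_sub_nonpos [IsFiniteMeasure P] (h : IsNoise P ℱ b V Y) {H : ℝ}
    (hH : ∀ n ω, ∑ s ∈ Finset.range n, V s ω ≤ H) (n : ℕ) :
    ∫ ω, (∑ s ∈ Finset.range n, Y s ω) ^ 4
      + 10 * (H - ∑ s ∈ Finset.range n, V s ω) * (∑ s ∈ Finset.range n, Y s ω) ^ 2
      - (2 * b ^ 2 + 10 * H) * ∑ s ∈ Finset.range n, V s ω ∂P ≤ 0 := by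
  set M : ℕ → Ω → ℝ := fun n ω => ∑ s ∈ Finset.range n, Y s ω
  set C : ℕ → Ω → ℝ := fun n ω => ∑ s ∈ Finset.range n, V s ω
  have hM (n : ℕ) : M n ∈ boundedMeasurable (ℱ n) := h.sum_range_mem_boundedMeasurable n
  have hC (n : ℕ) : C n ∈ boundedMeasurable (ℱ n) := h.sum_range_variance_mem_boundedMeasurable n
  have hD {m : MeasurableSpace Ω} {M C : Ω → ℝ} (hM : M ∈ boundedMeasurable m)
      (hC : C ∈ boundedMeasurable m) (c : ℝ) :
      (fun ω => M ω ^ 4 + 10 * (H - C ω) * M ω ^ 2 - c * C ω) ∈ boundedMeasurable m :=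
    sub_mem (add_mem (pow_mem hM 4) (mul_mem (mul_mem (const_mem_boundedMeasurable 10)
      (sub_mem (const_mem_boundedMeasurable H) hC)) (pow_mem hM 2)))
      (mul_mem (const_mem_boundedMeasurable _) hC)
  induction n with
  | zero => simp
  | succ n ih =>
    have hC' : (fun ω => C n ω + V n ω) ∈ boundedMeasurable (ℱ n) :=
      add_mem (hC n) (h.variance_mem n)
    have hslack (ω : Ω) : 0 ≤ H - (C n ω + V n ω) := by
      have := hH (n + 1) ω
      rw [Finset.sum_range_succ] at this
      exact sub_nonneg.2 this
    have hcount (ω : Ω) : 0 ≤ C n ω + V n ω :=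
      add_nonneg (Finset.sum_nonneg fun s _ => h.variance_nonneg s ω) (h.variance_nonneg n ω)
    refine (h.integral_le_of_le_quadratic n (hD (hM (n + 1)) (hC (n + 1)) _) (hD (hM n) (hC n) _)
      (hD (hM n) hC' (2 * b ^ 2 + 10 * H))
      (q := fun ω => 4 * M n ω ^ 3 + 20 * (H - (C n ω + V n ω)) * M n ω)
      (r := fun ω => 10 * M n ω ^ 2 + 2 * b ^ 2 + 10 * (H - (C n ω + V n ω)))
      (add_mem (mul_mem (const_mem_boundedMeasurable 4) (pow_mem (hM n) 3)) (mul_mem (mul_mem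
        (const_mem_boundedMeasurable 20) (sub_mem (const_mem_boundedMeasurable H) hC')) (hM n)))
      (add_mem (add_mem (mul_mem (const_mem_boundedMeasurable 10) (pow_mem (hM n) 2))
        (const_mem_boundedMeasurable (2 * b ^ 2))) (mul_mem (const_mem_boundedMeasurable 10)
          (sub_mem (const_mem_boundedMeasurable H) hC')))
      (fun ω => by have := hslack ω; positivity) (fun ω => ?_) fun ω => ?_).trans ih
    · have hstep := add_pow_four_le (M := M n ω) (h.abs_le n ω)
      simp only [M, C, Finset.sum_range_succ] at hstep ⊢
      linarith
    · linarith [mul_nonneg (hcount ω) (h.variance_nonneg n ω)]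

theorem integral_pow_four_le [IsFiniteMeasure P] (h : IsNoise P ℱ b V Y) {H : ℝ}
    (hH : ∀ n ω, ∑ s ∈ Finset.range n, V s ω ≤ H) (n : ℕ) :
    ∫ ω, (∑ s ∈ Finset.range n, Y s ω) ^ 4 ∂P
      ≤ (2 * b ^ 2 + 10 * H) * ∫ ω, ∑ s ∈ Finset.range n, V s ω ∂P := by
  have hM := h.sum_range_mem_boundedMeasurable n
  have hC := h.sum_range_variance_mem_boundedMeasurable n
  have hint {f : Ω → ℝ} (hf : f ∈ boundedMeasurable (ℱ n)) : Integrable f P :=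
    integrable_of_mem_boundedMeasurable (ℱ.le n) hf
  have hM4 := hint (pow_mem hM 4)
  have hκC := hint (mul_mem (const_mem_boundedMeasurable (2 * b ^ 2 + 10 * H)) hC)
  have hHC := hint (mul_mem (mul_mem (const_mem_boundedMeasurable 10)
    (sub_mem (const_mem_boundedMeasurable H) hC)) (pow_mem hM 2))
  rw [← integral_const_mul, ← sub_nonpos]
  refine ((integral_sub hM4 hκC).symm.trans_le
    (integral_mono (hM4.sub hκC) ((hM4.add hHC).sub hκC) fun ω => ?_)).trans
    (h.integral_pow_four_sub_nonpos hH n)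
  have : 0 ≤ 10 * (H - ∑ s ∈ Finset.range n, V s ω) * (∑ s ∈ Finset.range n, Y s ω) ^ 2 :=
    mul_nonneg (mul_nonneg (by norm_num) (sub_nonneg.2 (hH n ω))) (sq_nonneg _)
  exact sub_le_sub_right (le_add_of_nonneg_right this) _

theorem partialSups_abs_mem_boundedMeasurable (h : IsNoise P ℱ b V Y) (n : ℕ) :
    (fun ω => partialSups (fun i => |∑ s ∈ Finset.range i, Y s ω|) n)
      ∈ boundedMeasurable (ℱ n) := by
  have habs (n : ℕ) : (fun ω => |∑ s ∈ Finset.range n, Y s ω|) ∈ boundedMeasurable (ℱ n) :=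
    comp_mem_boundedMeasurable continuous_abs (h.sum_range_mem_boundedMeasurable n)
  induction n with
  | zero => simpa only [partialSups_zero] using habs 0
  | succ n ih =>
    simp only [partialSups_add_one]
    exact max_mem_boundedMeasurable (boundedMeasurable_mono (ℱ.mono n.le_succ) ih) (habs (n + 1))

theorem integral_doob_potential_nonpos [IsFiniteMeasure P] (h : IsNoise P ℱ b V Y) (n : ℕ) :
    ∫ ω, 3 * partialSups (fun i => |∑ s ∈ Finset.range i, Y s ω|) n ^ 4
      - 4 * |∑ s ∈ Finset.range n, Y s ω|
        * partialSups (fun i => |∑ s ∈ Finset.range i, Y s ω|) n ^ 3 ∂P ≤ 0 := by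
  set M : ℕ → Ω → ℝ := fun n ω => ∑ s ∈ Finset.range n, Y s ω
  set O : ℕ → Ω → ℝ := fun n ω => partialSups (fun i => |∑ s ∈ Finset.range i, Y s ω|) n
  have hM (n : ℕ) : M n ∈ boundedMeasurable (ℱ n) := h.sum_range_mem_boundedMeasurable n
  have hO (n : ℕ) : O n ∈ boundedMeasurable (ℱ n) := h.partialSups_abs_mem_boundedMeasurable n
  have hO0 (n : ℕ) (ω : Ω) : 0 ≤ O n ω :=
    (abs_nonneg _).trans (le_partialSups (fun i => |∑ s ∈ Finset.range i, Y s ω|) n)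
  have hD (n : ℕ) : (fun ω => 3 * O n ω ^ 4 - 4 * |M n ω| * O n ω ^ 3) ∈ boundedMeasurable (ℱ n) :=
    sub_mem (mul_mem (const_mem_boundedMeasurable 3) (pow_mem (hO n) 4))
      (mul_mem (mul_mem (const_mem_boundedMeasurable 4)
        (comp_mem_boundedMeasurable continuous_abs (hM n))) (pow_mem (hO n) 3))
  induction n with
  | zero => simp
  | succ n ih =>
    refine (h.integral_le_of_le_quadratic n (hD (n + 1)) (hD n) (hD n)
      (q := fun ω => -4 * Real.sign (M n ω) * O n ω ^ 3) (r := fun _ => 0)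
      (mul_mem (mul_mem (const_mem_boundedMeasurable (-4)) (sign_mem_boundedMeasurable (hM n)))
        (pow_mem (hO n) 3)) (const_mem_boundedMeasurable 0) (fun _ => le_rfl) (fun ω => ?_)
      fun ω => ?_).trans ih
    · have hmax : O (n + 1) ω = max (O n ω) |M (n + 1) ω| := partialSups_add_one _ n
      have habs : |M n ω| + Real.sign (M n ω) * Y n ω ≤ |M (n + 1) ω| := by
        simpa only [M, Finset.sum_range_succ] using abs_add_sign_mul_le (M n ω) (Y n ω)
      rw [hmax]
      linarith [three_mul_max_pow_sub_le (v := |M (n + 1) ω|) (hO0 n ω),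
        mul_le_mul_of_nonneg_right habs (pow_nonneg (hO0 n ω) 3)]
    · simp

theorem integral_partialSups_pow_four_le [IsFiniteMeasure P] (h : IsNoise P ℱ b V Y) (n : ℕ) :
    ∫ ω, partialSups (fun i => |∑ s ∈ Finset.range i, Y s ω|) n ^ 4 ∂P
      ≤ 27 / 8 * ∫ ω, (∑ s ∈ Finset.range n, Y s ω) ^ 4 ∂P := by
  have hint {f : Ω → ℝ} (hf : f ∈ boundedMeasurable (ℱ n)) : Integrable f P :=
    integrable_of_mem_boundedMeasurable (ℱ.le n) hf
  have hM := h.sum_range_mem_boundedMeasurable n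
  have hO := h.partialSups_abs_mem_boundedMeasurable n
  have hM4 := hint (mul_mem (const_mem_boundedMeasurable (27 / 8)) (pow_mem hM 4))
  have hD := hint (sub_mem (mul_mem (const_mem_boundedMeasurable 3) (pow_mem hO 4))
    (mul_mem (mul_mem (const_mem_boundedMeasurable 4)
      (comp_mem_boundedMeasurable continuous_abs hM)) (pow_mem hO 3)))
  rw [← integral_const_mul]
  refine (integral_mono (hint (pow_mem hO 4)) (hM4.add hD) fun ω => ?_).trans
    ((integral_add hM4 hD).trans_le
      (add_le_of_nonpos_right (h.integral_doob_potential_nonpos n)))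
  have hle := pow_four_le_doob ((abs_nonneg _).trans
    (le_partialSups (fun i => |∑ s ∈ Finset.range i, Y s ω|) n))
    (abs_nonneg (∑ s ∈ Finset.range n, Y s ω))
  rwa [← abs_pow, abs_of_nonneg (Even.pow_nonneg (by decide) _)] at hle

end IsNoise

/-! ### Blocks of selections -/

section Blocks

/-- The restriction of the sequence `y` to the `b`-th block of `H` consecutive selections, when
`N s` selections are made at slot `s`. -/
def blockRestrict {M : Type*} [Zero M] (N : ℕ → ℕ) (H b : ℕ) (y : ℕ → M) (s : ℕ) : M :=
  if (∑ r ∈ Finset.range s, N r) / H = b then y s else 0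

/-- The largest absolute value, up to slot `n`, of the sum of `y` within the `b`-th block. -/
def blockMax (N : ℕ → ℕ) (H b : ℕ) (y : ℕ → ℝ) (n : ℕ) : ℝ :=
  partialSups (fun i => |∑ s ∈ Finset.range i, blockRestrict N H b y s|) n

variable {N : ℕ → ℕ} {H : ℕ} {y : ℕ → ℝ}

theorem blockMax_nonneg (b n : ℕ) : 0 ≤ blockMax N H b y n :=
  (abs_nonneg _).trans (le_partialSups (fun i => |∑ s ∈ Finset.range i, blockRestrict N H b y s|) n)

theorem abs_sum_blockRestrict_le_blockMax (b : ℕ) {t n : ℕ} (h : t ≤ n) :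
    |∑ s ∈ Finset.range t, blockRestrict N H b y s| ≤ blockMax N H b y n :=
  le_partialSups_of_le (fun i => |∑ s ∈ Finset.range i, blockRestrict N H b y s|) h

theorem sum_blockRestrict_le_sub (N : ℕ → ℕ) (H b t : ℕ) :
    ∑ s ∈ Finset.range t, blockRestrict N H b N s ≤ ∑ s ∈ Finset.range t, N s - b * H := by
  induction t with
  | zero => simp
  | succ t ih =>
    rw [Finset.sum_range_succ, Finset.sum_range_succ, blockRestrict]
    split_ifs with h
    · have : b * H ≤ ∑ s ∈ Finset.range t, N s := h ▸ Nat.div_mul_le_self _ _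
      omega
    · omega

theorem sum_blockRestrict_le (hN : ∀ s, N s ≤ 1) (hH : 0 < H) (b t : ℕ) :
    ∑ s ∈ Finset.range t, blockRestrict N H b N s ≤ H := by
  induction t with
  | zero => simp
  | succ t ih =>
    rw [Finset.sum_range_succ, blockRestrict]
    split_ifs with h
    · have hle := sum_blockRestrict_le_sub N H b t
      have hlt : ∑ s ∈ Finset.range t, N s < (b + 1) * H :=
        (Nat.div_lt_iff_lt_mul hH).1 (Nat.lt_succ_of_le h.le)
      have := hN t
      rw [Nat.add_mul, one_mul] at hlt
      omega
    · omega

theorem sum_sum_blockRestrict_le (N : ℕ → ℕ) (H n t : ℕ) :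
    ∑ b ∈ Finset.range n, ∑ s ∈ Finset.range t, blockRestrict N H b N s
      ≤ ∑ s ∈ Finset.range t, N s := by
  rw [Finset.sum_comm]
  refine Finset.sum_le_sum fun s _ => ?_
  simp only [blockRestrict, Finset.sum_ite_eq]
  split_ifs
  exacts [le_rfl, zero_le]

theorem sum_range_le (hN : ∀ s, N s ≤ 1) (t : ℕ) : ∑ s ∈ Finset.range t, N s ≤ t := by
  simpa using Finset.sum_le_card_nsmul (Finset.range t) N 1 fun s _ => hN s

theorem sum_Ico_eq_sum_blockRestrict (hH : 0 < H) {s t : ℕ} (hst : s ≤ t)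
    (hn : ∑ r ∈ Finset.Ico s t, N r ≤ H) :
    ∑ r ∈ Finset.Ico s t, y r
      = ∑ b ∈ {(∑ r ∈ Finset.range t, N r) / H - 1, (∑ r ∈ Finset.range t, N r) / H},
        ∑ r ∈ Finset.Ico s t, blockRestrict N H b y r := by
  rw [Finset.sum_comm]
  refine Finset.sum_congr rfl fun r hr => ?_
  obtain ⟨hsr, hrt⟩ := Finset.mem_Ico.1 hr
  simp only [blockRestrict, Finset.sum_ite_eq]
  rw [if_pos]
  have hsplit := Finset.sum_range_add_sum_Ico N hst
  have hs : ∑ i ∈ Finset.range s, N i ≤ ∑ i ∈ Finset.range r, N i :=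
    Finset.sum_le_sum_of_subset (Finset.range_mono hsr)
  have ht : (∑ i ∈ Finset.range r, N i) / H ≤ (∑ i ∈ Finset.range t, N i) / H :=
    Nat.div_le_div_right (Finset.sum_le_sum_of_subset (Finset.range_mono hrt.le))
  have hH' : (∑ i ∈ Finset.range t, N i) / H ≤ (∑ i ∈ Finset.range r, N i) / H + 1 := by
    rw [← Nat.add_div_right _ hH]
    exact Nat.div_le_div_right (by omega)
  rw [Finset.mem_insert, Finset.mem_singleton]
  generalize (∑ i ∈ Finset.range r, N i) / H = p at ht hH' ⊢
  omega

theorem sum_Ico_pow_four_le (hH : 0 < H) {s t n : ℕ} (hst : s ≤ t) (htn : t ≤ n)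
    (hn : ∑ r ∈ Finset.Ico s t, N r ≤ H) :
    (∑ r ∈ Finset.Ico s t, y r) ^ 4
      ≤ 128 * ∑ b ∈ {(∑ r ∈ Finset.range t, N r) / H - 1, (∑ r ∈ Finset.range t, N r) / H},
        blockMax N H b y n ^ 4 := by
  have hblock (b : ℕ) : |∑ r ∈ Finset.Ico s t, blockRestrict N H b y r|
      ≤ 2 * blockMax N H b y n := by
    rw [Finset.sum_Ico_eq_sub _ hst, two_mul]
    exact (abs_sub _ _).trans (add_le_add (abs_sum_blockRestrict_le_blockMax b htn)
      (abs_sum_blockRestrict_le_blockMax b (hst.trans htn)))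
  have hZ (b : ℕ) : 0 ≤ 2 * blockMax N H b y n := mul_nonneg zero_le_two (blockMax_nonneg b n)
  rw [sum_Ico_eq_sum_blockRestrict hH hst hn, ← Even.pow_abs (by decide)]
  generalize (∑ r ∈ Finset.range t, N r) / H = q
  refine (pow_le_pow_left₀ (abs_nonneg _) ((Finset.abs_sum_le_sum_abs _ _).trans
    (Finset.sum_le_sum fun b _ => hblock b)) 4).trans ?_
  cases q with
  | zero =>
    simp only [zero_tsub, Finset.mem_singleton, Finset.insert_eq_of_mem, Finset.sum_singleton]
    rw [mul_pow]
    have : 0 ≤ blockMax N H 0 y n ^ 4 := pow_nonneg (blockMax_nonneg 0 n) 4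
    linarith
  | succ q =>
    rw [add_tsub_cancel_right, Finset.sum_pair q.succ_ne_self.symm,
      Finset.sum_pair q.succ_ne_self.symm]
    exact (add_pow_le (hZ q) (hZ (q + 1)) 4).trans_eq (by ring)

-- A selection in block `q` is charged to the blocks `q` and `q - 1`.
theorem mul_sum_near_le {n t : ℕ} (hN : ∀ s, N s ≤ 1) (htn : t ≤ n) {Z : ℕ → ℝ}
    (hZ : ∀ b, 0 ≤ Z b) :
    (N t : ℝ) * ∑ b ∈ {(∑ r ∈ Finset.range t, N r) / H - 1, (∑ r ∈ Finset.range t, N r) / H}, Z b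
      ≤ ∑ b ∈ Finset.range (n + 1),
        Z b * (blockRestrict N H b N t + blockRestrict N H (b + 1) N t : ℕ) := by
  have hq : (∑ r ∈ Finset.range t, N r) / H ≤ n :=
    (Nat.div_le_self _ _).trans ((sum_range_le hN t).trans htn)
  rw [Finset.mul_sum]
  refine (Finset.sum_le_sum fun b hb => ?_).trans (Finset.sum_le_sum_of_subset_of_nonneg
    (fun b hb => ?_) fun b _ _ => mul_nonneg (hZ b) (Nat.cast_nonneg _))
  · rw [mul_comm]
    refine mul_le_mul_of_nonneg_left (Nat.cast_le.2 ?_) (hZ b)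
    rw [Finset.mem_insert, Finset.mem_singleton] at hb
    unfold blockRestrict
    generalize (∑ r ∈ Finset.range t, N r) / H = q at hb
    split_ifs <;> omega
  · rw [Finset.mem_insert, Finset.mem_singleton] at hb
    rw [Finset.mem_range]
    omega

theorem sum_mul_window_pow_four_le (hN : ∀ s, N s ≤ 1) (hH : 0 < H) (y : ℕ → ℝ) (τ n : ℕ) :
    ∑ t ∈ Finset.range n, (if ∑ s ∈ Finset.Ico (t - τ) t, N s ≤ H then
      (N t : ℝ) * (∑ s ∈ Finset.Ico (t - τ) t, y s) ^ 4 else 0)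
      ≤ 256 * H * ∑ b ∈ Finset.range (n + 1), blockMax N H b y n ^ 4 := by
  have hZ (b : ℕ) : 0 ≤ 128 * blockMax N H b y n ^ 4 :=
    mul_nonneg (by norm_num) (pow_nonneg (blockMax_nonneg b n) 4)
  calc _ ≤ ∑ t ∈ Finset.range n, ∑ b ∈ Finset.range (n + 1), 128 * blockMax N H b y n ^ 4
        * (blockRestrict N H b N t + blockRestrict N H (b + 1) N t : ℕ) := by
        refine Finset.sum_le_sum fun t ht => ?_
        have htn := (Finset.mem_range.1 ht).le
        split_ifs with hn
        · refine le_trans ?_ (mul_sum_near_le hN htn hZ)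
          rw [← Finset.mul_sum]
          exact mul_le_mul_of_nonneg_left (sum_Ico_pow_four_le hH (Nat.sub_le t τ) htn hn)
            (Nat.cast_nonneg _)
        · exact Finset.sum_nonneg fun b _ => mul_nonneg (hZ b) (Nat.cast_nonneg _)
    _ ≤ ∑ b ∈ Finset.range (n + 1), 128 * blockMax N H b y n ^ 4 * (2 * H) := by
        rw [Finset.sum_comm]
        refine Finset.sum_le_sum fun b _ => ?_
        rw [← Finset.mul_sum]
        refine mul_le_mul_of_nonneg_left ?_ (hZ b)
        rw [← Nat.cast_sum, Finset.sum_add_distrib, two_mul]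
        exact_mod_cast add_le_add (sum_blockRestrict_le hN hH b n)
          (sum_blockRestrict_le hN hH (b + 1) n)
    _ = _ := by
        rw [Finset.mul_sum]
        exact Finset.sum_congr rfl fun b _ => by ring

end Blocks

namespace IsNoise

variable {Ω : Type*} {mΩ : MeasurableSpace Ω} {P : Measure Ω} {ℱ : Filtration ℕ mΩ} {b : ℝ}
  {Y : ℕ → Ω → ℝ}

theorem indicator [IsFiniteMeasure P] {V : ℕ → Ω → ℝ} (h : IsNoise P ℱ b V Y) {A : ℕ → Set Ω}
    (hA : ∀ s, MeasurableSet[ℱ s] (A s)) :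
    IsNoise P ℱ b (fun s => (A s).indicator (V s)) (fun s => (A s).indicator (Y s)) where
  variance_mem s := indicator_mem_boundedMeasurable (h.variance_mem s) (hA s)
  variance_nonneg s := Set.indicator_nonneg fun ω _ => h.variance_nonneg s ω
  measurable s := (h.measurable s).indicator (ℱ.mono s.le_succ _ (hA s))
  abs_le s ω := (Real.norm_eq_abs _).symm.trans_le
    ((norm_indicator_le_norm_self _ _).trans (h.abs_le s ω))
  condExp_eq_zero s := by
    have hY := integrable_of_mem_boundedMeasurable (P := P) (ℱ.le _)
      (h.mem_boundedMeasurable s.lt_succ_self)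
    filter_upwards [condExp_indicator hY (hA s), h.condExp_eq_zero s] with ω h1 h2
    rw [h1, Set.indicator_apply_eq_zero.2 fun _ => h2, Pi.zero_apply]
  condExp_sq_le s := by
    have hY := integrable_of_mem_boundedMeasurable (P := P) (ℱ.le _)
      (pow_mem (h.mem_boundedMeasurable s.lt_succ_self) 2)
    have hsq : (A s).indicator (Y s) ^ 2 = (A s).indicator (Y s ^ 2) := by
      classical
      ext ω
      simp only [Pi.pow_apply, Set.indicator_apply, ite_pow, zero_pow two_ne_zero]
    rw [hsq]
    filter_upwards [condExp_indicator hY (hA s), h.condExp_sq_le s] with ω h1 h2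
    exact h1.trans_le (Set.indicator_le_indicator h2)

variable {N : ℕ → Ω → ℕ} {H : ℕ}

theorem blockRestrict [IsFiniteMeasure P] (h : IsNoise P ℱ b (fun s ω => (N s ω : ℝ)) Y)
    (H j : ℕ) :
    IsNoise P ℱ b (fun s ω => ((blockRestrict (fun r => N r ω) H j (fun r => N r ω) s : ℕ) : ℝ))
      (fun s ω => blockRestrict (fun r => N r ω) H j (fun r => Y r ω) s) := by
  have hA (s : ℕ) : MeasurableSet[ℱ s]
      ((fun ω => ⌊(∑ r ∈ Finset.range s, (N r ω : ℝ)) / H⌋₊) ⁻¹' {j}) :=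
    Nat.measurable_floor.comp ((h.sum_range_variance_mem_boundedMeasurable s).1.div_const (H : ℝ))
      (measurableSet_singleton j)
  have hmem (s : ℕ) (ω : Ω) : ω ∈ (fun ω => ⌊(∑ r ∈ Finset.range s, (N r ω : ℝ)) / H⌋₊) ⁻¹' {j}
      ↔ (∑ r ∈ Finset.range s, N r ω) / H = j := by
    rw [Set.mem_preimage, Set.mem_singleton_iff, ← Nat.cast_sum, Nat.floor_div_eq_div]
  classical
  convert h.indicator hA using 1 <;> ext s ω <;>
    simp only [SWRMOSS.blockRestrict, Set.indicator_apply, hmem, Nat.cast_ite, Nat.cast_zero]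

theorem blockMax_mem_boundedMeasurable [IsFiniteMeasure P]
    (h : IsNoise P ℱ b (fun s ω => (N s ω : ℝ)) Y) (H j n : ℕ) :
    (fun ω => blockMax (fun r => N r ω) H j (fun r => Y r ω) n) ∈ boundedMeasurable (ℱ n) :=
  (h.blockRestrict H j).partialSups_abs_mem_boundedMeasurable n

theorem integral_blockMax_pow_four_le [IsFiniteMeasure P]
    (h : IsNoise P ℱ b (fun s ω => (N s ω : ℝ)) Y) (hN : ∀ s ω, N s ω ≤ 1) (hH : 0 < H)
    (j n : ℕ) :
    ∫ ω, blockMax (fun r => N r ω) H j (fun r => Y r ω) n ^ 4 ∂P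
      ≤ 27 / 8 * (2 * b ^ 2 + 10 * H) * ∫ ω, ∑ s ∈ Finset.range n,
        ((SWRMOSS.blockRestrict (fun r => N r ω) H j (fun r => N r ω) s : ℕ) : ℝ) ∂P := by
  have hb := h.blockRestrict H j
  refine (hb.integral_partialSups_pow_four_le n).trans ?_
  rw [mul_assoc]
  refine mul_le_mul_of_nonneg_left ?_ (by norm_num)
  refine hb.integral_pow_four_le (fun n ω => ?_) n
  exact_mod_cast sum_blockRestrict_le (fun s => hN s ω) hH j n

/-- Within each block of `H` selections, Doob's inequality controls all windows at once. -/
theorem integral_window_pow_four_le [IsFiniteMeasure P]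
    (h : IsNoise P ℱ b (fun s ω => (N s ω : ℝ)) Y) (hN : ∀ s ω, N s ω ≤ 1) (hH : 0 < H)
    (τ n : ℕ) :
    ∫ ω, ∑ t ∈ Finset.range n, (if ∑ s ∈ Finset.Ico (t - τ) t, N s ω ≤ H then
      (N t ω : ℝ) * (∑ s ∈ Finset.Ico (t - τ) t, Y s ω) ^ 4 else 0) ∂P
      ≤ 864 * H * (2 * b ^ 2 + 10 * H) * ∫ ω, ∑ s ∈ Finset.range n, (N s ω : ℝ) ∂P := by
  have hint {f : Ω → ℝ} (hf : f ∈ boundedMeasurable (ℱ n)) : Integrable f P :=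
    integrable_of_mem_boundedMeasurable (ℱ.le n) hf
  have hZ (j : ℕ) : Integrable
      (fun ω => blockMax (fun r => N r ω) H j (fun r => Y r ω) n ^ 4) P :=
    hint (pow_mem (h.blockMax_mem_boundedMeasurable H j n) 4)
  have hC (j : ℕ) := hint ((h.blockRestrict H j).sum_range_variance_mem_boundedMeasurable n)
  have hCN := hint (h.sum_range_variance_mem_boundedMeasurable n)
  calc _ ≤ ∫ ω, 256 * H * ∑ j ∈ Finset.range (n + 1),
        blockMax (fun r => N r ω) H j (fun r => Y r ω) n ^ 4 ∂P := by
        refine integral_mono_of_nonneg (ae_of_all _ fun ω => Finset.sum_nonneg fun t _ => ?_)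
          ((integrable_finsetSum _ fun j _ => hZ j).const_mul _) (ae_of_all _ fun ω =>
            sum_mul_window_pow_four_le (fun s => hN s ω) hH (fun s => Y s ω) τ n)
        split_ifs <;> positivity
    _ = 256 * H * ∑ j ∈ Finset.range (n + 1),
        ∫ ω, blockMax (fun r => N r ω) H j (fun r => Y r ω) n ^ 4 ∂P := by
        rw [integral_const_mul, integral_finsetSum _ fun j _ => hZ j]
    _ ≤ 256 * H * ∑ j ∈ Finset.range (n + 1), 27 / 8 * (2 * b ^ 2 + 10 * H) *
        ∫ ω, ∑ s ∈ Finset.range n,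
          ((SWRMOSS.blockRestrict (fun r => N r ω) H j (fun r => N r ω) s : ℕ) : ℝ) ∂P := by
        gcongr with j
        exact h.integral_blockMax_pow_four_le hN hH j n
    _ = 864 * H * (2 * b ^ 2 + 10 * H) * ∫ ω, ∑ j ∈ Finset.range (n + 1),
        ∑ s ∈ Finset.range n,
          ((SWRMOSS.blockRestrict (fun r => N r ω) H j (fun r => N r ω) s : ℕ) : ℝ) ∂P := by
        rw [integral_finsetSum _ fun j _ => hC j, ← Finset.mul_sum]
        ring
    _ ≤ _ := by
        refine mul_le_mul_of_nonneg_left (integral_mono (integrable_finsetSum _ fun j _ => hC j)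
          hCN fun ω => ?_) (by positivity)
        exact_mod_cast sum_sum_blockRestrict_le (fun r => N r ω) H (n + 1) n

end IsNoise

/-! ### Saturated rewards and the law of a run -/

section Saturation

theorem sat_eq_max_min (x : ℝ) {B : ℝ} (hB : 0 ≤ B) : sat x B = max (-B) (min x B) := by
  unfold sat
  rcases lt_trichotomy x 0 with h | rfl | h
  · rw [Real.sign_of_neg h, abs_of_neg h, min_eq_left (h.le.trans hB), neg_one_mul, ← max_neg_neg,
      neg_neg, max_comm]
  · simp [hB]
  · rw [Real.sign_of_pos h, abs_of_pos h, one_mul,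
      max_eq_right ((neg_nonpos.2 hB).trans (le_min h.le hB))]

theorem measurable_sat {B : ℝ} (hB : 0 ≤ B) : Measurable fun x => sat x B := by
  simp only [sat_eq_max_min _ hB]
  fun_prop

theorem abs_sat_le (x : ℝ) {B : ℝ} (hB : 0 ≤ B) : |sat x B| ≤ B := by
  rw [sat_eq_max_min _ hB, abs_le]
  exact ⟨le_max_left _ _, max_le (by linarith) (min_le_right _ _)⟩

theorem abs_sat_le_abs (x : ℝ) {B : ℝ} (hB : 0 ≤ B) : |sat x B| ≤ |x| := by
  rw [sat_eq_max_min _ hB, abs_le]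
  refine ⟨le_max_of_le_right (le_min (neg_abs_le x) ?_), max_le ?_ ?_⟩
  · linarith [abs_nonneg x]
  · linarith [abs_nonneg x]
  · exact (min_le_left _ _).trans (le_abs_self x)

theorem abs_sat_sub_le (x : ℝ) {B : ℝ} (hB : 0 < B) : |sat x B - x| ≤ x ^ 2 / B := by
  rw [sat_eq_max_min _ hB.le, le_div_iff₀ hB]
  rcases le_total x B with h | h
  · rw [min_eq_left h]
    rcases le_total (-B) x with h' | h'
    · rw [max_eq_right h', sub_self, abs_zero, zero_mul]
      exact sq_nonneg x
    · rw [max_eq_left h', abs_of_nonneg (by linarith)]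
      nlinarith
  · rw [min_eq_right h, max_eq_right (by linarith), abs_of_nonpos (by linarith)]
    nlinarith

variable {μ : Measure ℝ}

theorem integrable_sat [IsFiniteMeasure μ] {B : ℝ} (hB : 0 ≤ B) :
    Integrable (fun x => sat x B) μ :=
  .of_bound (measurable_sat hB).aestronglyMeasurable B (ae_of_all _ fun x => abs_sat_le x hB)

theorem abs_integral_sat_le [IsProbabilityMeasure μ] {B : ℝ} (hB : 0 ≤ B) :
    |∫ x, sat x B ∂μ| ≤ B := by
  simpa using norm_integral_le_of_norm_le_const (μ := μ) (f := fun x => sat x B) (C := B)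
    (ae_of_all _ fun x => abs_sat_le x hB)

theorem abs_integral_sat_sub_le [IsFiniteMeasure μ] {B : ℝ} (hB : 0 < B)
    (hμ : MemLp (fun x : ℝ => x) 2 μ) :
    |∫ x, sat x B ∂μ - ∫ x, x ∂μ| ≤ (∫ x, x ^ 2 ∂μ) / B := by
  have hs := integrable_sat (μ := μ) hB.le
  have hx := hμ.integrable one_le_two
  calc |∫ x, sat x B ∂μ - ∫ x, x ∂μ| = |∫ x, sat x B - x ∂μ| := by rw [integral_sub hs hx]
    _ ≤ ∫ x, |sat x B - x| ∂μ := abs_integral_le_integral_abs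
    _ ≤ ∫ x, x ^ 2 / B ∂μ := integral_mono (hs.sub hx).abs (hμ.integrable_sq.div_const B)
          fun x => abs_sat_sub_le x hB
    _ = (∫ x, x ^ 2 ∂μ) / B := integral_div _ _

theorem integral_sat_sub_sq_le [IsProbabilityMeasure μ] {B : ℝ} (hB : 0 ≤ B)
    (hμ : MemLp (fun x : ℝ => x) 2 μ) :
    ∫ x, (sat x B - ∫ z, sat z B ∂μ) ^ 2 ∂μ ≤ ∫ x, x ^ 2 ∂μ := by
  have hsat : MemLp (fun x => sat x B) 2 μ :=
    .of_bound (measurable_sat hB).aestronglyMeasurable B (ae_of_all _ fun x => abs_sat_le x hB)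
  rw [← variance_eq_integral (measurable_sat hB).aemeasurable]
  exact (variance_le_expectation_sq hsat.aestronglyMeasurable).trans
    (integral_mono hsat.integrable_sq hμ.integrable_sq fun x => sq_le_sq.2 (abs_sat_le_abs x hB))

end Saturation

namespace Environment

variable {K T : ℕ} {ν : Environment K T}

namespace HeavyTailed

theorem memLp (hν : ν.HeavyTailed) (t : Fin T) (k : Fin K) :
    MemLp (fun x : ℝ => x) 2 (ν t k : Measure ℝ) := by
  have hfin : HasFiniteIntegral (fun x : ℝ => x ^ 2) (ν t k : Measure ℝ) :=
    (hasFiniteIntegral_iff_ofReal (ae_of_all _ sq_nonneg)).2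
      ((hν t k).trans_lt ENNReal.one_lt_top)
  exact (memLp_two_iff_integrable_sq aestronglyMeasurable_id).2 ⟨by fun_prop, hfin⟩

theorem integral_sq_le_one (hν : ν.HeavyTailed) (t : Fin T) (k : Fin K) :
    ∫ x, x ^ 2 ∂(ν t k : Measure ℝ) ≤ 1 := by
  rw [integral_eq_lintegral_of_nonneg_ae (ae_of_all _ sq_nonneg) (by fun_prop)]
  exact ENNReal.toReal_mono ENNReal.one_ne_top (hν t k)

theorem abs_mean_le_one (hν : ν.HeavyTailed) (t : Fin T) (k : Fin K) : |ν.mean t k| ≤ 1 := by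
  have hvar := variance_nonneg (fun x => x) (ν t k : Measure ℝ)
  rw [variance_eq_sub (hν.memLp t k)] at hvar
  rw [abs_le_one_iff_mul_self_le_one, ← sq]
  exact (sub_nonneg.1 hvar).trans (hν.integral_sq_le_one t k)

theorem abs_integral_sat_sub_mean_le (hν : ν.HeavyTailed) {B : ℝ} (hB : 0 < B) (t : Fin T)
    (k : Fin K) : |∫ x, sat x B ∂(ν t k : Measure ℝ) - ν.mean t k| ≤ 1 / B :=
  (abs_integral_sat_sub_le hB (hν.memLp t k)).trans
    (div_le_div_of_nonneg_right (hν.integral_sq_le_one t k) hB.le)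

end HeavyTailed

instance isProbabilityMeasure_rewardLaw (ν : Environment K T) :
    IsProbabilityMeasure ν.rewardLaw := by
  unfold rewardLaw
  infer_instance

theorem measurePreserving_reward (ν : Environment K T) (t : Fin T) (k : Fin K) :
    MeasurePreserving (fun x : Fin T → Fin K → ℝ => x t k) ν.rewardLaw (ν t k : Measure ℝ) :=
  (measurePreserving_eval (fun k => (ν t k : Measure ℝ)) k).comp
    (measurePreserving_eval (fun t => Measure.pi fun k => (ν t k : Measure ℝ)) t)

end Environment

section PastRewards

variable {K T : ℕ}

/-- The filtration on tables of rewards: at time `s`, the rewards of all arms at the slots before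
`s` are known. -/
def pastRewards (K T : ℕ) :
    Filtration ℕ (MeasurableSpace.pi : MeasurableSpace (Fin T → Fin K → ℝ)) where
  seq s := ⨆ i ∈ {i : Fin T | (i : ℕ) < s}, MeasurableSpace.comap (fun x => x i) inferInstance
  mono' _ _ hst := biSup_mono fun _ hi => lt_of_lt_of_le hi hst
  le' _ := iSup₂_le fun i _ => (measurable_pi_apply i).comap_le

theorem measurable_pastRewards {s : ℕ} {t : Fin T} (h : (t : ℕ) < s) :
    Measurable[pastRewards K T s] fun x : Fin T → Fin K → ℝ => x t :=
  measurable_iff_comap_le.2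
    (le_iSup₂_of_le (f := fun (i : Fin T) (_ : i ∈ {i : Fin T | (i : ℕ) < s}) =>
      MeasurableSpace.comap (fun x : Fin T → Fin K → ℝ => x i) inferInstance) t h le_rfl)

theorem Environment.condExp_reward (ν : Environment K T) {f : ℝ → ℝ} (hf : Measurable f) (t : Fin T)
    (k : Fin K) :
    ν.rewardLaw[fun x => f (x t k) | pastRewards K T t] =ᵐ[ν.rewardLaw]
      fun _ => ∫ z, f z ∂(ν t k : Measure ℝ) := by
  have hind : iIndepFun (fun (t : Fin T) (x : Fin T → Fin K → ℝ) => x t) ν.rewardLaw :=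
    iIndepFun_pi fun _ => aemeasurable_id
  have hle (i : Fin T) : MeasurableSpace.comap (fun x : Fin T → Fin K → ℝ => x i) inferInstance
      ≤ MeasurableSpace.pi := (measurable_pi_apply i).comap_le
  have hpast := indep_iSup_of_disjoint hle hind
    (Set.disjoint_singleton_left.2 (lt_irrefl (t : ℕ)) :
      Disjoint {t} {i : Fin T | (i : ℕ) < (t : ℕ)})
  rw [iSup_singleton] at hpast
  have hmeas : StronglyMeasurable[MeasurableSpace.comap (fun x : Fin T → Fin K → ℝ => x t)
      inferInstance] fun x : Fin T → Fin K → ℝ => f (x t k) :=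
    (hf.comp ((measurable_pi_apply k).comp (comap_measurable _))).stronglyMeasurable
  have hmap := ν.measurePreserving_reward t k
  filter_upwards [condExp_indep_eq (hle t) ((pastRewards K T).le t) hmeas hpast] with x hx
  rw [hx, ← hmap.map_eq, integral_map hmap.measurable.aemeasurable hf.aestronglyMeasurable]

end PastRewards

namespace Environment

variable {K T : ℕ} {ν : Environment K T}

theorem exists_mean_eq_bestMean (ν : Environment K T) (hK : 0 < K) (t : Fin T) :
    ∃ k, ν.mean t k = ν.bestMean t := by
  have : Nonempty (Fin K) := ⟨⟨0, hK⟩⟩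
  exact exists_eq_ciSup_of_finite

theorem HeavyTailed.bestMean_sub_mean_le_two (hν : ν.HeavyTailed) (hK : 0 < K) (t : Fin T)
    (k : Fin K) : ν.bestMean t - ν.mean t k ≤ 2 := by
  obtain ⟨j, hj⟩ := ν.exists_mean_eq_bestMean hK t
  rw [← hj]
  linarith [(abs_le.1 (hν.abs_mean_le_one t j)).2, (abs_le.1 (hν.abs_mean_le_one t k)).1]

end Environment

namespace Policy

variable {K T : ℕ} {π : Policy K}

theorem history_apply (π : Policy K) (x : Fin T → Fin K → ℝ) (t : ℕ) (h : t ≤ T) (s : Fin t) :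
    π.history x t h s = (π.arm x ⟨s, s.isLt.trans_le h⟩,
      x ⟨s, s.isLt.trans_le h⟩ (π.arm x ⟨s, s.isLt.trans_le h⟩)) := by
  induction t with
  | zero => exact s.elim0
  | succ t ih =>
    refine Fin.lastCases ?_ (fun i => ?_) s
    · simp [history, arm]
    · simp only [history, Fin.snoc_castSucc]
      exact ih _ i

theorem measurable_history {Ω : Type*} {m : MeasurableSpace Ω} {X : Ω → Fin T → Fin K → ℝ}
    (hπ : ∀ t, Measurable (π t)) {t : ℕ} (h : t ≤ T)
    (hX : ∀ i : Fin T, (i : ℕ) < t → Measurable fun ω => X ω i) :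
    Measurable fun ω => π.history (X ω) t h := by
  induction t with
  | zero => exact measurable_pi_iff.2 fun i => i.elim0
  | succ t ih =>
    have hpast := ih (Nat.le_of_succ_le h) fun i hi => hX i (hi.trans t.lt_succ_self)
    have harm := (hπ t).comp hpast
    have heval : Measurable fun p : (Fin K → ℝ) × Fin K => p.1 p.2 :=
      measurable_from_prod_countable_left fun k => measurable_pi_apply k
    refine measurable_pi_iff.2 fun i => Fin.lastCases ?_ (fun i => ?_) i
    · simp only [history, Fin.snoc_last]
      exact harm.prodMk (heval.comp ((hX ⟨t, h⟩ t.lt_succ_self).prodMk harm))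
    · simp only [history, Fin.snoc_castSucc]
      exact (measurable_pi_apply i).comp hpast

theorem measurable_arm (hπ : ∀ t, Measurable (π t)) (t : Fin T) :
    Measurable[pastRewards K T t] fun x => π.arm x t :=
  (hπ t).comp (measurable_history hπ t.isLt.le fun _ => measurable_pastRewards)

theorem measurableSet_arm_eq (hπ : ∀ t, Measurable (π t)) (t : Fin T) (k : Fin K) :
    MeasurableSet[pastRewards K T t] {x | π.arm x t = k} :=
  measurable_arm hπ t (measurableSet_singleton k)

theorem condExp_indicator_reward (hπ : ∀ t, Measurable (π t)) {ν : Environment K T} {f : ℝ → ℝ}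
    (hf : Measurable f) (t : Fin T) (k : Fin K) (hfi : Integrable f (ν t k : Measure ℝ)) :
    ν.rewardLaw[{x | π.arm x t = k}.indicator fun x => f (x t k) | pastRewards K T t]
      =ᵐ[ν.rewardLaw] {x | π.arm x t = k}.indicator fun _ => ∫ z, f z ∂(ν t k : Measure ℝ) := by
  have hi : Integrable (fun x => f (x t k)) ν.rewardLaw :=
    (ν.measurePreserving_reward t k).integrable_comp_of_integrable hfi
  filter_upwards [condExp_indicator hi (measurableSet_arm_eq hπ t k), ν.condExp_reward hf t k]
    with x h1 h2
  rw [h1, Set.indicator_apply, Set.indicator_apply, ← h2]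

end Policy

section Regret

variable {K T : ℕ} {π : Policy K} {ν : Environment K T}

theorem apply_arm_eq_sum_indicator (π : Policy K) (f : (Fin T → Fin K → ℝ) → Fin K → ℝ)
    (t : Fin T) :
    (fun x => f x (π.arm x t)) = fun x => ∑ k, {x | π.arm x t = k}.indicator (f · k) x := by
  ext x
  simp [Set.indicator_apply]

theorem integrable_reward_indicator (hπ : ∀ t, Measurable (π t)) (hν : ν.HeavyTailed) (t : Fin T)
    (k : Fin K) : Integrable ({x | π.arm x t = k}.indicator fun x => x t k) ν.rewardLaw :=
  ((ν.measurePreserving_reward t k).integrable_comp_of_integrable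
    ((hν.memLp t k).integrable one_le_two)).indicator
    ((pastRewards K T).le t _ (Policy.measurableSet_arm_eq hπ t k))

theorem integrable_reward_arm (hπ : ∀ t, Measurable (π t)) (hν : ν.HeavyTailed) (t : Fin T) :
    Integrable (fun x => x t (π.arm x t)) ν.rewardLaw := by
  rw [apply_arm_eq_sum_indicator π (fun x k => x t k) t]
  exact integrable_finsetSum _ fun k _ => integrable_reward_indicator hπ hν t k

theorem integrable_mean_arm (hπ : ∀ t, Measurable (π t)) (ν : Environment K T) (t : Fin T) :
    Integrable (fun x => ν.mean t (π.arm x t)) ν.rewardLaw := by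
  rw [apply_arm_eq_sum_indicator π (fun _ k => ν.mean t k) t]
  exact integrable_finsetSum _ fun k _ => (integrable_const _).indicator
    ((pastRewards K T).le t _ (Policy.measurableSet_arm_eq hπ t k))

theorem integral_reward_arm (hπ : ∀ t, Measurable (π t)) (hν : ν.HeavyTailed) (t : Fin T) :
    ∫ x, x t (π.arm x t) ∂ν.rewardLaw = ∫ x, ν.mean t (π.arm x t) ∂ν.rewardLaw := by
  rw [apply_arm_eq_sum_indicator π (fun x k => x t k) t,
    apply_arm_eq_sum_indicator π (fun _ k => ν.mean t k) t,
    integral_finsetSum _ fun k _ => integrable_reward_indicator hπ hν t k,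
    integral_finsetSum _ fun k _ => (integrable_const _).indicator
      ((pastRewards K T).le t _ (Policy.measurableSet_arm_eq hπ t k))]
  refine Finset.sum_congr rfl fun k _ => ?_
  rw [← integral_condExp ((pastRewards K T).le t)]
  exact integral_congr_ae (Policy.condExp_indicator_reward hπ measurable_id t k
    ((hν.memLp t k).integrable one_le_two))

theorem regret_eq_integral_sum_loss (hπ : ∀ t, Measurable (π t)) (hν : ν.HeavyTailed) :
    π.regret ν = ∫ x, ∑ t : Fin T, (ν.bestMean t - ν.mean t (π.arm x t)) ∂ν.rewardLaw := by
  have hloss (t : Fin T) : ∫ x, (ν.bestMean t - ν.mean t (π.arm x t)) ∂ν.rewardLaw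
      = ν.bestMean t - ∫ x, x t (π.arm x t) ∂ν.rewardLaw := by
    rw [integral_sub (integrable_const _) (integrable_mean_arm hπ ν t),
      integral_reward_arm hπ hν t, integral_const, probReal_univ, one_smul]
  rw [Policy.regret, integral_finsetSum _ fun t _ => integrable_reward_arm hπ hν t,
    ← Finset.sum_sub_distrib]
  simp only [← hloss]
  exact (integral_finsetSum _ fun t _ =>
    (integrable_const _).sub (integrable_mean_arm hπ ν t)).symm

theorem integrable_sum_loss (hπ : ∀ t, Measurable (π t)) (ν : Environment K T) :
    Integrable (fun x => ∑ t : Fin T, (ν.bestMean t - ν.mean t (π.arm x t))) ν.rewardLaw :=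
  integrable_finsetSum _ fun t _ => (integrable_const _).sub (integrable_mean_arm hπ ν t)

theorem regret_le_two_mul (hπ : ∀ t, Measurable (π t)) (hν : ν.HeavyTailed) (hK : 0 < K) :
    π.regret ν ≤ 2 * T := by
  rw [regret_eq_integral_sum_loss hπ hν]
  calc ∫ x, ∑ t : Fin T, (ν.bestMean t - ν.mean t (π.arm x t)) ∂ν.rewardLaw
      ≤ ∫ _, ∑ _t : Fin T, (2 : ℝ) ∂ν.rewardLaw :=
        integral_mono (integrable_sum_loss hπ ν) (integrable_const _) fun x =>
          Finset.sum_le_sum fun t _ => hν.bestMean_sub_mean_le_two hK t _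
    _ = 2 * T := by simp [mul_comm]

end Regret

section Noise

variable {K T : ℕ} {π : Policy K} {ν : Environment K T} {B : ℝ} {k : Fin K}

/-- The number, `0` or `1`, of selections of arm `k` at slot `s`. All processes are indexed by `ℕ`
and vanish at the slots `s ≥ T`, which do not exist. -/
def pulled (π : Policy K) (k : Fin K) (s : ℕ) (x : Fin T → Fin K → ℝ) : ℕ :=
  if h : s < T then if π.arm x ⟨s, h⟩ = k then 1 else 0 else 0

/-- The number of selections of arm `k` in the slots `s, …, t - 1`. -/
def pullCount (π : Policy K) (k : Fin K) (s t : ℕ) (x : Fin T → Fin K → ℝ) : ℕ :=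
  ∑ r ∈ Finset.Ico s t, pulled π k r x

/-- The centered saturated reward of arm `k` at slot `s` if the arm is selected, and `0`
otherwise: the martingale increments that perturb the index of arm `k`. -/
def noise (π : Policy K) (ν : Environment K T) (B : ℝ) (k : Fin K) (s : ℕ)
    (x : Fin T → Fin K → ℝ) : ℝ :=
  if h : s < T then
    if π.arm x ⟨s, h⟩ = k then sat (x ⟨s, h⟩ k) B - ∫ z, sat z B ∂(ν ⟨s, h⟩ k : Measure ℝ) else 0
  else 0

/-- The sum of the noise of arm `k` over the slots `s, …, t - 1`. -/
def noiseSum (π : Policy K) (ν : Environment K T) (B : ℝ) (k : Fin K) (s t : ℕ)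
    (x : Fin T → Fin K → ℝ) : ℝ :=
  ∑ r ∈ Finset.Ico s t, noise π ν B k r x

theorem pulled_le_one (s : ℕ) (x : Fin T → Fin K → ℝ) : pulled π k s x ≤ 1 := by
  unfold pulled
  split_ifs <;> simp

theorem sum_pulled_eq_one {t : ℕ} (ht : t < T) (x : Fin T → Fin K → ℝ) :
    ∑ k, pulled π k t x = 1 := by
  simp [pulled, ht]

theorem pulled_eq_indicator (t : Fin T) :
    (fun x => (pulled π k t x : ℝ)) = {x | π.arm x t = k}.indicator fun _ => 1 := by
  ext x
  simp [pulled, Set.indicator_apply]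

theorem noise_eq_indicator (t : Fin T) :
    noise π ν B k t = {x | π.arm x t = k}.indicator
      fun x => sat (x t k) B - ∫ z, sat z B ∂(ν t k : Measure ℝ) := by
  ext x
  simp [noise, Set.indicator_apply]

theorem pulled_eq_zero {s : ℕ} (hs : T ≤ s) : pulled (T := T) π k s = 0 := by
  ext x
  simp [pulled, hs.not_gt]

theorem noise_eq_zero {s : ℕ} (hs : T ≤ s) : noise π ν B k s = 0 := by
  ext x
  simp [noise, hs.not_gt]

theorem abs_noise_le (hB : 0 ≤ B) (s : ℕ) (x : Fin T → Fin K → ℝ) :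
    |noise π ν B k s x| ≤ 2 * B := by
  have hzero : |(0 : ℝ)| ≤ 2 * B := by simpa using hB
  unfold noise
  split_ifs
  · rw [two_mul]
    exact (abs_sub _ _).trans (add_le_add (abs_sat_le _ hB) (abs_integral_sat_le hB))
  · exact hzero
  · exact hzero

theorem condExp_noise_eq_zero (hπ : ∀ t, Measurable (π t)) (hB : 0 ≤ B) (t : Fin T) :
    ν.rewardLaw[noise π ν B k t | pastRewards K T t] =ᵐ[ν.rewardLaw] 0 := by
  rw [noise_eq_indicator]
  refine (Policy.condExp_indicator_reward hπ ((measurable_sat hB).sub_const _) t k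
    ((integrable_sat hB).sub (integrable_const _))).trans (.of_eq ?_)
  ext x
  simp [integral_sub (integrable_sat hB) (integrable_const _)]

theorem condExp_noise_sq_le (hπ : ∀ t, Measurable (π t)) (hν : ν.HeavyTailed) (hB : 0 ≤ B)
    (t : Fin T) : ν.rewardLaw[noise π ν B k t ^ 2 | pastRewards K T t] ≤ᵐ[ν.rewardLaw]
      fun x => (pulled π k t x : ℝ) := by
  have hsq : noise π ν B k t ^ 2 = {x | π.arm x t = k}.indicator
      fun x => (sat (x t k) B - ∫ z, sat z B ∂(ν t k : Measure ℝ)) ^ 2 := by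
    ext x
    simp [noise_eq_indicator, Set.indicator_apply]
  have hint : Integrable (fun y => (sat y B - ∫ z, sat z B ∂(ν t k : Measure ℝ)) ^ 2)
      (ν t k : Measure ℝ) :=
    ((memLp_of_bounded (a := -B) (b := B) (ae_of_all _ fun y => abs_le.1 (abs_sat_le y hB))
      (measurable_sat hB).aestronglyMeasurable 2).sub (memLp_const _)).integrable_sq
  rw [hsq, pulled_eq_indicator]
  filter_upwards [Policy.condExp_indicator_reward hπ (((measurable_sat hB).sub_const _).pow_const 2)
    t k hint] with x hx
  rw [hx]
  exact Set.indicator_le_indicator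
    ((integral_sat_sub_sq_le hB (hν.memLp t k)).trans (hν.integral_sq_le_one t k))

theorem measurable_noise (hπ : ∀ t, Measurable (π t)) (hB : 0 ≤ B) (t : Fin T) :
    Measurable[pastRewards K T (t + 1)] (noise π ν B k t) := by
  rw [noise_eq_indicator]
  exact (((measurable_sat hB).comp ((measurable_pi_apply k).comp
    (measurable_pastRewards t.val.lt_succ_self))).sub_const _).indicator
    ((pastRewards K T).mono t.val.le_succ _ (Policy.measurableSet_arm_eq hπ t k))

theorem pulled_mem_boundedMeasurable (hπ : ∀ t, Measurable (π t)) (t : Fin T) :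
    (fun x => (pulled π k t x : ℝ)) ∈ boundedMeasurable (pastRewards K T t) := by
  rw [pulled_eq_indicator]
  exact indicator_mem_boundedMeasurable (const_mem_boundedMeasurable 1)
    (Policy.measurableSet_arm_eq hπ t k)

theorem isNoise_noise (hπ : ∀ t, Measurable (π t)) (hν : ν.HeavyTailed) (hB : 0 ≤ B)
    (k : Fin K) : IsNoise ν.rewardLaw (pastRewards K T) (2 * B)
      (fun s x => (pulled π k s x : ℝ)) (noise π ν B k) where
  variance_nonneg s x := Nat.cast_nonneg _
  abs_le := abs_noise_le hB
  variance_mem s := by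
    rcases lt_or_ge s T with hs | hs
    · exact pulled_mem_boundedMeasurable hπ ⟨s, hs⟩
    · simpa [pulled_eq_zero hs] using const_mem_boundedMeasurable 0
  measurable s := by
    rcases lt_or_ge s T with hs | hs
    · exact measurable_noise hπ hB ⟨s, hs⟩
    · rw [noise_eq_zero hs]
      exact measurable_const
  condExp_eq_zero s := by
    rcases lt_or_ge s T with hs | hs
    · exact condExp_noise_eq_zero hπ hB ⟨s, hs⟩
    · rw [noise_eq_zero hs, condExp_zero]
  condExp_sq_le s := by
    rcases lt_or_ge s T with hs | hs
    · exact condExp_noise_sq_le hπ hν hB ⟨s, hs⟩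
    · rw [noise_eq_zero hs, zero_pow two_ne_zero, condExp_zero]
      exact .of_forall fun x => Nat.cast_nonneg _

end Noise

/-! ### Sums over the levels -/

section GeometricSums

/-- A bump function with geometric decay at `0` and at `∞`: its sums along geometric progressions
are bounded independently of the starting point. -/
def bump (y : ℝ) : ℝ := y / (1 + y) ^ 2

theorem bump_le_sub {q z : ℝ} (hq : 1 < q) (hz : 0 < z) :
    bump z ≤ q / (q - 1) * (q * z / (1 + q * z) - z / (1 + z)) := by
  have hq1 : 0 < q - 1 := sub_pos.2 hq
  have hdiff : q / (q - 1) * (q * z / (1 + q * z) - z / (1 + z))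
      = z / ((1 + z) * ((1 + q * z) / q)) := by
    field_simp
    ring
  rw [hdiff, bump, sq]
  gcongr
  rw [div_le_iff₀ (by positivity)]
  nlinarith

theorem sum_bump_le {q y : ℝ} (hq : 1 < q) (hy : 0 < y) (n : ℕ) :
    ∑ l ∈ Finset.range n, bump (q ^ l * y) ≤ q / (q - 1) := by
  set F : ℕ → ℝ := fun l => q ^ l * y / (1 + q ^ l * y)
  have hF0 : 0 ≤ F 0 := by positivity
  have hFn : F n ≤ 1 := div_le_one_of_le₀ (by linarith) (by positivity)
  have hq1 : 0 ≤ q / (q - 1) := div_nonneg (by linarith) (by linarith)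
  calc ∑ l ∈ Finset.range n, bump (q ^ l * y)
      ≤ ∑ l ∈ Finset.range n, q / (q - 1) * (F (l + 1) - F l) := by
        refine Finset.sum_le_sum fun l _ => ?_
        simpa only [F, pow_succ', mul_assoc] using
          bump_le_sub hq (mul_pos (pow_pos (one_pos.trans hq) l) hy)
    _ = q / (q - 1) * (F n - F 0) := by rw [← Finset.mul_sum, Finset.sum_range_sub]
    _ ≤ q / (q - 1) := mul_le_of_le_one_right hq1 (by linarith)

theorem inv_sq_mul_le_bump {Q ρ e : ℝ} (hQ : 0 < Q) (hρ : 0 < ρ) (he : e ≤ 1)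
    (heQ : e ≤ Q ^ 4 / ρ ^ 4) : e / Q ^ 2 ≤ 4 * bump (Q * ρ⁻¹) / ρ ^ 2 := by
  obtain ⟨y, hy, rfl⟩ : ∃ y, 0 < y ∧ Q = y * ρ := ⟨Q / ρ, by positivity, by field_simp⟩
  have hey : e ≤ y ^ 4 := heQ.trans_eq (by field_simp)
  rw [mul_pow, ← div_div, mul_inv_cancel_right₀ hρ.ne']
  gcongr
  rw [bump, mul_div_assoc', div_le_div_iff₀ (by positivity) (by positivity)]
  rcases le_total y 1 with hy1 | hy1
  · calc e * (1 + y) ^ 2 ≤ y ^ 4 * (1 + 1) ^ 2 := by gcongr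
      _ = 4 * y ^ 3 * y := by ring
      _ ≤ 4 * y ^ 3 * 1 := by gcongr
      _ = 4 * y * y ^ 2 := by ring
  · calc e * (1 + y) ^ 2 ≤ 1 * (y + y) ^ 2 := by gcongr
      _ = 4 * y ^ 2 * 1 := by ring
      _ ≤ 4 * y ^ 2 * y := by gcongr
      _ = 4 * y * y ^ 2 := by ring

end GeometricSums

section Slack

/-- Size of the deviations that are not charged to the noise, for `u ^ 4` samples, when
`ρ ^ 4 = τ / K`. -/
def slack (ρ u : ℝ) : ℝ := ρ / u ^ 3 + 1 / ρ ^ 2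

variable {ρ u v : ℝ}

theorem slack_anti (hρ : 0 < ρ) (hu : 0 < u) (huv : u ≤ v) : slack ρ v ≤ slack ρ u := by
  unfold slack
  gcongr

theorem slack_pos (hρ : 0 < ρ) (hu : 0 < u) : 0 < slack ρ u := by
  unfold slack
  positivity

theorem slack_le_eight_mul (hρ : 0 < ρ) (hu : 0 < u) (hv : 0 < v) (hvu : v ≤ 2 * u) :
    slack ρ u ≤ 8 * slack ρ v := by
  have hcube : ρ / u ^ 3 ≤ 8 * (ρ / v ^ 3) := by
    rw [mul_div_assoc', div_le_div_iff₀ (by positivity) (by positivity)]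
    calc ρ * v ^ 3 ≤ ρ * (2 * u) ^ 3 := by gcongr
      _ = 8 * ρ * u ^ 3 := by ring
  have hsq : 0 < 1 / ρ ^ 2 := by positivity
  unfold slack
  linarith

theorem inv_sq_le_slack (hρ : 0 < ρ) (hu : 0 < u) : 1 / u ^ 2 ≤ slack ρ u := by
  rcases le_total u ρ with h | h
  · calc 1 / u ^ 2 = u / u ^ 3 := by field_simp
      _ ≤ ρ / u ^ 3 := by gcongr
      _ ≤ slack ρ u := le_add_of_nonneg_right (by positivity)
  · calc 1 / u ^ 2 ≤ 1 / ρ ^ 2 := by gcongr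
      _ ≤ slack ρ u := le_add_of_nonneg_left (by positivity)

theorem inv_slack_pow_le_bump {Q : ℝ} (hQ : 0 < Q) (hρ : 0 < ρ) :
    1 / (Q ^ 8 * slack ρ Q ^ 3) ≤ 4 * bump (Q * ρ⁻¹) / ρ ^ 2 := by
  obtain ⟨y, hy, rfl⟩ : ∃ y, 0 < y ∧ Q = y * ρ := ⟨Q / ρ, by positivity, by field_simp⟩
  have hscale : 1 / ((y * ρ) ^ 8 * slack ρ (y * ρ) ^ 3) = y / (1 + y ^ 3) ^ 3 / ρ ^ 2 := by
    unfold slack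
    field_simp
  have hpow : (1 + y) ^ 2 ≤ 4 * (1 + y ^ 3) ^ 3 := by
    have hself : 1 + y ^ 3 ≤ (1 + y ^ 3) ^ 3 :=
      le_self_pow₀ (le_add_of_nonneg_right (by positivity)) (by norm_num)
    rcases le_total y 1 with hy1 | hy1
    · nlinarith [pow_pos hy 3]
    · have : y ^ 2 ≤ y ^ 3 := pow_le_pow_right₀ hy1 (by norm_num)
      nlinarith
  rw [hscale, mul_inv_cancel_right₀ hρ.ne']
  gcongr
  rw [bump, mul_div_assoc', div_le_div_iff₀ (by positivity) (by positivity)]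
  calc y * (1 + y) ^ 2 ≤ y * (4 * (1 + y ^ 3) ^ 3) := by gcongr
    _ = 4 * y * (1 + y ^ 3) ^ 3 := by ring

theorem le_add_pow_div {v θ : ℝ} (hv : 0 ≤ v) (hθ : 0 < θ) : v ≤ θ + v ^ 4 / θ ^ 3 := by
  rcases le_total v θ with h | h
  · exact h.trans (le_add_of_nonneg_right (by positivity))
  · refine le_add_of_nonneg_of_le hθ.le ((le_div_iff₀ (by positivity)).2 ?_)
    calc v * θ ^ 3 ≤ v * v ^ 3 := by gcongr
      _ = v ^ 4 := by ring

theorem div_le_add_mul_pow_four {a H n θ S : ℝ} (hn : 0 < n) (hnH : n < H) (hHn : H ≤ a * n)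
    (hθ : 0 < θ) : S / n ≤ θ + a ^ 4 / (H ^ 4 * θ ^ 3) * S ^ 4 := by
  have hH : 0 < H := hn.trans hnH
  have hmean : |S| / n ≤ a / H * |S| := by
    rw [div_mul_eq_mul_div, div_le_div_iff₀ hn hH]
    nlinarith [mul_le_mul_of_nonneg_left hHn (abs_nonneg S)]
  calc S / n ≤ |S| / n := by gcongr; exact le_abs_self S
    _ ≤ θ + (|S| / n) ^ 4 / θ ^ 3 := le_add_pow_div (by positivity) hθ
    _ ≤ θ + (a / H * |S|) ^ 4 / θ ^ 3 := by gcongr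
    _ = θ + a ^ 4 / (H ^ 4 * θ ^ 3) * S ^ 4 := by
        rw [mul_pow, Even.pow_abs (by decide)]
        field_simp

end Slack

section LnPlus

theorem one_le_lnPlus (x : ℝ) : 1 ≤ lnPlus x := le_max_right _ _

theorem lnPlus_mono {x y : ℝ} (hx : 0 < x) (h : x ≤ y) : lnPlus x ≤ lnPlus y :=
  max_le_max_right 1 (Real.log_le_log hx h)

theorem exp_neg_lnPlus_le {x : ℝ} (hx : 0 < x) : Real.exp (-lnPlus x) ≤ 1 / x := by
  calc Real.exp (-lnPlus x) ≤ Real.exp (-Real.log x) :=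
        Real.exp_le_exp.2 (neg_le_neg (le_max_left _ _))
    _ = 1 / x := by rw [Real.exp_neg, Real.exp_log hx, one_div]

theorem lnPlus_pow_four_le {w : ℝ} (hw : 0 < w) : lnPlus (w ^ 4) ≤ (2 * w + 1) ^ 2 := by
  refine max_le ?_ (by nlinarith)
  have hlog : Real.log (w ^ 4) = 2 * Real.log (w ^ 2) := by
    rw [Real.log_pow, Real.log_pow]
    push_cast
    ring
  nlinarith [Real.log_le_sub_one_of_pos (pow_pos hw 2)]

theorem radius_le_slack {K τ n : ℕ} {ρ u : ℝ} (hρ : 0 < ρ) (hu : 0 < u)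
    (hρ4 : ρ ^ 4 = (τ : ℝ) / K) (hu4 : u ^ 4 = n) : radius K τ n ≤ 3 * slack ρ u := by
  have hratio : (τ : ℝ) / (K * n) = (ρ / u) ^ 4 := by rw [div_pow, hρ4, hu4, div_div]
  have hsqrt : radius K τ n ≤ (2 * (ρ / u) + 1) / u ^ 2 := by
    refine Real.sqrt_le_iff.2 ⟨by positivity, ?_⟩
    rw [hratio, ← hu4, div_pow (2 * (ρ / u) + 1), ← pow_mul]
    gcongr
    exact lnPlus_pow_four_le (by positivity)
  have hcube : ρ / u ^ 3 ≤ slack ρ u := le_add_of_nonneg_right (by positivity)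
  calc radius K τ n ≤ (2 * (ρ / u) + 1) / u ^ 2 := hsqrt
    _ = 2 * (ρ / u ^ 3) + 1 / u ^ 2 := by field_simp
    _ ≤ 3 * slack ρ u := by linarith [inv_sq_le_slack hρ hu]

end LnPlus

section Levels

variable {a : ℝ}

/-- The exponent of `gridUp a m`: sample sizes of the same level share one saturation limit. -/
def level (a : ℝ) (m : ℕ) : ℕ := ⌊Real.logb a m⌋₊ + 1

theorem lt_pow_level (ha : 1 < a) {m : ℕ} (hm : 0 < m) : (m : ℝ) < a ^ level a m := by
  rw [level, ← Real.rpow_natCast, ← Real.logb_lt_iff_lt_rpow ha (Nat.cast_pos.2 hm)]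
  exact_mod_cast Nat.lt_floor_add_one (Real.logb a m)

theorem pow_level_le (ha : 1 < a) {m : ℕ} (hm : 0 < m) : a ^ level a m ≤ a * m := by
  have hfloor := Nat.floor_le (Real.logb_nonneg ha (Nat.one_le_cast.2 hm))
  rw [Real.le_logb_iff_rpow_le ha (Nat.cast_pos.2 hm), Real.rpow_natCast] at hfloor
  rw [level, pow_succ']
  gcongr

theorem level_mono (ha : 1 < a) {m n : ℕ} (hm : 0 < m) (hmn : m ≤ n) :
    level a m ≤ level a n :=
  Nat.add_le_add_right (Nat.floor_mono
    (Real.logb_le_logb_of_le ha (Nat.cast_pos.2 hm) (Nat.cast_le.2 hmn))) 1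

/-- The saturation limit of the sample sizes of level `l`. -/
def levelLimit (a : ℝ) (K τ l : ℕ) : ℝ :=
  Real.sqrt (a ^ l / lnPlus ((τ : ℝ) / (K * a ^ l)))

theorem satLimit_eq_levelLimit (a : ℝ) (K τ m : ℕ) :
    satLimit a K τ m = levelLimit a K τ (level a m) := rfl

variable {K τ : ℕ}

theorem levelLimit_pos (ha : 1 < a) (l : ℕ) : 0 < levelLimit a K τ l :=
  Real.sqrt_pos.2 (div_pos (by positivity) (one_pos.trans_le (one_le_lnPlus _)))

theorem levelLimit_sq_mul (ha : 1 < a) (l : ℕ) :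
    levelLimit a K τ l ^ 2 * lnPlus ((τ : ℝ) / (K * a ^ l)) = a ^ l := by
  have hpos := one_pos.trans_le (one_le_lnPlus ((τ : ℝ) / (K * a ^ l)))
  rw [levelLimit, Real.sq_sqrt (by positivity), div_mul_cancel₀ _ hpos.ne']

theorem levelLimit_sq_le (ha : 1 < a) (l : ℕ) : levelLimit a K τ l ^ 2 ≤ a ^ l :=
  (le_mul_of_one_le_right (sq_nonneg _) (one_le_lnPlus _)).trans_eq (levelLimit_sq_mul ha l)

theorem inv_levelLimit_le_radius (ha : 1 < a) (hK : 0 < K) (hτ : 0 < τ) {n : ℕ} (hn : 0 < n) :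
    1 / levelLimit a K τ (level a n) ≤ radius K τ n := by
  have hH := lt_pow_level ha hn
  have hlnPlus := one_pos.trans_le (one_le_lnPlus ((τ : ℝ) / (K * n)))
  rw [levelLimit, one_div, ← Real.sqrt_inv, inv_div, radius]
  gcongr
  exact lnPlus_mono (by positivity) (by gcongr)

end Levels

section ExponentialBound

/-- The parameter of the exponential moment that is used at saturation limit `B`. -/
def expParam (a ζ B : ℝ) : ℝ := Real.log (1 + 2 * ζ / a) / (2 * B)

/-- The factor of the exponential moment that bounds the deviation below the mean, for saturation
limit `B` and between `H / a` and `H` samples. -/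
def expCoeff (a ζ B H : ℝ) : ℝ :=
  a / (H * expParam a ζ B) * Real.exp (-expParam a ζ B * (ζ * H / (a * B))
    + expRate (2 * B) (expParam a ζ B) * H)

variable {a ζ B H : ℝ}

theorem log_one_add_pos (ha : 0 < a) (hζ : 0 < ζ) : 0 < Real.log (1 + 2 * ζ / a) :=
  Real.log_pos (lt_add_of_pos_right 1 (by positivity))

theorem expParam_pos (ha : 0 < a) (hζ : 0 < ζ) (hB : 0 < B) : 0 < expParam a ζ B :=
  div_pos (log_one_add_pos ha hζ) (by positivity)

theorem expCoeff_nonneg (ha : 0 < a) (hζ : 0 < ζ) (hB : 0 < B) (hH : 0 ≤ H) :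
    0 ≤ expCoeff a ζ B H := by
  have := expParam_pos ha hζ hB
  unfold expCoeff
  positivity

theorem max_zero_le_exp_div {l : ℝ} (hl : 0 < l) (z : ℝ) : max z 0 ≤ Real.exp (l * z) / l := by
  rw [le_div_iff₀ hl]
  rcases max_cases z 0 with ⟨h, _⟩ | ⟨h, _⟩ <;> rw [h]
  · linarith [Real.add_one_le_exp (l * z)]
  · linarith [Real.exp_pos (l * z)]

theorem neg_div_sub_le_expCoeff_mul {n : ℝ} (S : ℝ) (ha : 0 < a) (hζ : 0 < ζ) (hB : 0 < B)
    (hn : 0 < n) (hnH : n < H) (hHn : H ≤ a * n) :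
    -(S / n) - ζ / B ≤ expCoeff a ζ B H
      * Real.exp (-expParam a ζ B * S - expRate (2 * B) (expParam a ζ B) * n) := by
  have hH : 0 < H := hn.trans hnH
  have hl := expParam_pos ha hζ hB
  have hg := expRate_nonneg (2 * B) (expParam a ζ B)
  set l := expParam a ζ B with hldef
  set g := expRate (2 * B) l with hgdef
  have hshift : ζ * H / (a * B) ≤ n * ζ / B := by
    rw [div_le_div_iff₀ (by positivity) hB]
    nlinarith [mul_le_mul_of_nonneg_left hHn (mul_pos hζ hB).le]
  have hinv : 1 / n ≤ a / H := by
    rw [div_le_div_iff₀ hn hH]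
    linarith
  calc -(S / n) - ζ / B = 1 / n * (-S - n * ζ / B) := by field_simp
    _ ≤ 1 / n * max (-S - ζ * H / (a * B)) 0 := by
        gcongr
        exact le_max_of_le_left (by linarith)
    _ ≤ a / H * max (-S - ζ * H / (a * B)) 0 := by gcongr
    _ ≤ a / H * (Real.exp (l * (-S - ζ * H / (a * B))) / l) := by
        gcongr
        exact max_zero_le_exp_div hl _
    _ = a / (H * l) * Real.exp (l * (-S - ζ * H / (a * B))) := by field_simp
    _ ≤ a / (H * l) * Real.exp ((-l * (ζ * H / (a * B)) + g * H) + (-l * S - g * n)) := by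
        gcongr
        nlinarith [mul_le_mul_of_nonneg_left hnH.le hg]
    _ = expCoeff a ζ B H * Real.exp (-l * S - g * n) := by
        rw [Real.exp_add, expCoeff, ← hldef, ← hgdef, mul_assoc]

theorem four_le_of_le_psi (ha : 0 < a) (hζ : 0 < ζ) (hψ : 2 * a / ζ ≤ psi (2 * ζ / a)) :
    4 ≤ (1 + 2 * ζ / a) * Real.log (1 + 2 * ζ / a) - 2 * ζ / a := by
  have hpsi : 2 * ζ / a * psi (2 * ζ / a)
      = (1 + 2 * ζ / a) * Real.log (1 + 2 * ζ / a) - 2 * ζ / a := by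
    unfold psi
    field_simp
    ring
  calc (4 : ℝ) = 2 * ζ / a * (2 * a / ζ) := by field_simp; norm_num
    _ ≤ 2 * ζ / a * psi (2 * ζ / a) := by gcongr
    _ = _ := hpsi

-- `l = log (1 + 2ζ/a) / 2B` minimizes the exponent; its minimum is `-Λ y ψ(y) / 4`, `y = 2ζ/a`.
theorem exponent_le_neg {Λ : ℝ} (ha : 0 < a) (hζ : 0 < ζ) (hψ : 2 * a / ζ ≤ psi (2 * ζ / a))
    (hB : 0 < B) (hΛ : 0 ≤ Λ) (hH : B ^ 2 * Λ = H) :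
    -expParam a ζ B * (ζ * H / (a * B)) + expRate (2 * B) (expParam a ζ B) * H ≤ -Λ := by
  have hlog := four_le_of_le_psi ha hζ hψ
  have hparam : 2 * B * expParam a ζ B = Real.log (1 + 2 * ζ / a) := by
    unfold expParam
    field_simp
  have hrate : expRate (2 * B) (expParam a ζ B) * H
      = (2 * ζ / a - Real.log (1 + 2 * ζ / a)) / 4 * Λ := by
    rw [expRate, hparam, Real.exp_log (by positivity), ← hH]
    field_simp
    ring
  have hdrift : expParam a ζ B * (ζ * H / (a * B))
      = Real.log (1 + 2 * ζ / a) * (2 * ζ / a) / 4 * Λ := by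
    rw [expParam, ← hH]
    field_simp
    ring
  rw [neg_mul, hrate, hdrift]
  nlinarith

theorem expCoeff_le {Λ : ℝ} (ha : 0 < a) (hζ : 0 < ζ) (hψ : 2 * a / ζ ≤ psi (2 * ζ / a))
    (hB : 0 < B) (hΛ : 1 ≤ Λ) (hH : B ^ 2 * Λ = H) :
    expCoeff a ζ B H
      ≤ 2 * a / Real.log (1 + 2 * ζ / a) * (Real.exp (-Λ) / Real.sqrt H) := by
  have hH0 : 0 < H := by rw [← hH]; positivity
  have hlog := log_one_add_pos ha hζ
  have hsqrt : B ≤ Real.sqrt H :=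
    Real.le_sqrt_of_sq_le (hH ▸ le_mul_of_one_le_right (sq_nonneg B) hΛ)
  calc expCoeff a ζ B H = 2 * a / Real.log (1 + 2 * ζ / a) * (B / H)
        * Real.exp (-expParam a ζ B * (ζ * H / (a * B))
          + expRate (2 * B) (expParam a ζ B) * H) := by
        rw [expCoeff]
        congr 1
        rw [expParam]
        field_simp
    _ ≤ 2 * a / Real.log (1 + 2 * ζ / a) * (Real.sqrt H / H) * Real.exp (-Λ) := by
        gcongr
        exact exponent_le_neg ha hζ hψ hB (by linarith) hH
    _ = 2 * a / Real.log (1 + 2 * ζ / a) * (Real.exp (-Λ) / Real.sqrt H) := by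
        rw [Real.sqrt_div_self']
        ring

theorem sum_expCoeff_le {q ρ : ℝ} (ha : 1 < a) (hζ : 0 < ζ)
    (hψ : 2 * a / ζ ≤ psi (2 * ζ / a)) (hq : 1 < q) (hqa : q ^ 4 = a) {K τ : ℕ} (hK : 0 < K)
    (hτ : 0 < τ) (hρ : 0 < ρ) (hρ4 : ρ ^ 4 = (τ : ℝ) / K) (n : ℕ) :
    ∑ l ∈ Finset.range n, expCoeff a ζ (levelLimit a K τ l) (a ^ l)
      ≤ 2 * a / Real.log (1 + 2 * ζ / a) * (4 * (q / (q - 1))) / ρ ^ 2 := by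
  have ha0 : 0 < a := by linarith
  have hlog := log_one_add_pos ha0 hζ
  have hterm (l : ℕ) : expCoeff a ζ (levelLimit a K τ l) (a ^ l)
      ≤ 2 * a / Real.log (1 + 2 * ζ / a) * (4 * bump (q ^ l * ρ⁻¹) / ρ ^ 2) := by
    have hH : a ^ l = (q ^ l) ^ 4 := by rw [← hqa, ← pow_mul, ← pow_mul, mul_comm]
    have hsqrt : Real.sqrt (a ^ l) = (q ^ l) ^ 2 := by
      rw [hH, show (q ^ l) ^ 4 = ((q ^ l) ^ 2) ^ 2 by ring, Real.sqrt_sq (by positivity)]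
    refine (expCoeff_le ha0 hζ hψ (levelLimit_pos ha l) (one_le_lnPlus _)
      (levelLimit_sq_mul (K := K) (τ := τ) ha l)).trans ?_
    rw [hsqrt]
    refine mul_le_mul_of_nonneg_left (inv_sq_mul_le_bump (by positivity) hρ ?_ ?_) (by positivity)
    · rw [Real.exp_le_one_iff]
      linarith [one_le_lnPlus ((τ : ℝ) / (K * a ^ l))]
    · refine (exp_neg_lnPlus_le (by positivity)).trans_eq ?_
      rw [hρ4, ← hH]
      field_simp
  calc ∑ l ∈ Finset.range n, expCoeff a ζ (levelLimit a K τ l) (a ^ l)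
      ≤ ∑ l ∈ Finset.range n, 2 * a / Real.log (1 + 2 * ζ / a)
        * (4 * bump (q ^ l * ρ⁻¹) / ρ ^ 2) := Finset.sum_le_sum fun l _ => hterm l
    _ = 2 * a / Real.log (1 + 2 * ζ / a) * (4 * ∑ l ∈ Finset.range n, bump (q ^ l * ρ⁻¹))
        / ρ ^ 2 := by
        rw [← Finset.mul_sum, ← Finset.sum_div, ← Finset.mul_sum]
        ring
    _ ≤ 2 * a / Real.log (1 + 2 * ζ / a) * (4 * (q / (q - 1))) / ρ ^ 2 := by
        gcongr
        exact sum_bump_le hq (by positivity) n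

end ExponentialBound

/-! ### Windows with few samples -/

section Windows

/-- The fourth root of a natural number. -/
def fourthRoot (n : ℕ) : ℝ := (n : ℝ) ^ (1 / 4 : ℝ)

theorem fourthRoot_zero : fourthRoot 0 = 0 := by simp [fourthRoot]

theorem fourthRoot_one : fourthRoot 1 = 1 := by simp [fourthRoot]

theorem fourthRoot_nonneg (n : ℕ) : 0 ≤ fourthRoot n := Real.rpow_nonneg n.cast_nonneg _

theorem fourthRoot_pos {n : ℕ} (hn : 0 < n) : 0 < fourthRoot n :=
  Real.rpow_pos_of_pos (Nat.cast_pos.2 hn) _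

theorem fourthRoot_pow (n : ℕ) : fourthRoot n ^ 4 = n := by
  rw [fourthRoot, ← Real.rpow_natCast, ← Real.rpow_mul n.cast_nonneg]
  norm_num

theorem fourthRoot_mono : Monotone fourthRoot := fun m n h => by
  unfold fourthRoot
  gcongr

theorem fourthRoot_succ_le {n : ℕ} (hn : 0 < n) : fourthRoot (n + 1) ≤ 2 * fourthRoot n := by
  have hroot := fourthRoot_pos hn
  refine le_of_pow_le_pow_left₀ (n := 4) (by norm_num) (by positivity) ?_
  have hone : (1 : ℝ) ≤ n := Nat.one_le_cast.2 hn
  rw [mul_pow, fourthRoot_pow, fourthRoot_pow]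
  push_cast
  linarith

theorem one_div_fourthRoot_pow_le (n : ℕ) :
    1 / fourthRoot (n + 1) ^ 3 ≤ 4 * (fourthRoot (n + 1) - fourthRoot n) := by
  have hu := fourthRoot_pos n.succ_pos
  have hv := fourthRoot_nonneg n
  have hvu := fourthRoot_mono n.le_succ
  have hu4 := fourthRoot_pow (n + 1)
  have hv4 := fourthRoot_pow n
  push_cast at hu4
  simp only [Nat.succ_eq_add_one] at hu hvu
  set u := fourthRoot (n + 1)
  set v := fourthRoot n
  have hfactor : (u - v) * (u ^ 3 + u ^ 2 * v + u * v ^ 2 + v ^ 3) = 1 := by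
    linear_combination hu4 - hv4
  have hsum : u ^ 3 + u ^ 2 * v + u * v ^ 2 + v ^ 3 ≤ 4 * u ^ 3 :=
    calc u ^ 3 + u ^ 2 * v + u * v ^ 2 + v ^ 3
        ≤ u ^ 3 + u ^ 2 * u + u * u ^ 2 + u ^ 3 := by gcongr
      _ = 4 * u ^ 3 := by ring
  rw [div_le_iff₀ (by positivity)]
  rw [← hfactor]
  linarith [mul_le_mul_of_nonneg_left hsum (sub_nonneg.2 hvu)]

theorem mul_fourthRoot_le {ρ : ℝ} (hρ : 0 < ρ) (n : ℕ) :
    ρ * fourthRoot n ≤ ρ ^ 2 + n / ρ ^ 2 := by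
  have hyoung := le_add_pow_div (fourthRoot_nonneg n) hρ
  rw [fourthRoot_pow] at hyoung
  calc ρ * fourthRoot n ≤ ρ * (ρ + n / ρ ^ 3) := by gcongr
    _ = ρ ^ 2 + n / ρ ^ 2 := by field_simp

-- Inside a block of `τ` slots the window contains the part of the block seen so far, so the sum
-- telescopes.
theorem sum_div_fourthRoot_window_le {N : ℕ → ℕ} (hN : ∀ t, N t ≤ 1) {τ j : ℕ} (hj : j ≤ τ)
    (s : ℕ) : ∑ t ∈ Finset.Ico s (s + j),
      (N t : ℝ) * (1 / fourthRoot (∑ r ∈ Finset.Ico (t - τ) t, N r + 1) ^ 3)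
      ≤ 4 * fourthRoot (∑ t ∈ Finset.Ico s (s + j), N t) := by
  induction j with
  | zero => simp [fourthRoot_zero]
  | succ j ih =>
    rw [← add_assoc, Finset.sum_Ico_succ_top (by omega), Finset.sum_Ico_succ_top (by omega)]
    specialize ih (by omega)
    obtain h | h := Nat.le_one_iff_eq_zero_or_eq_one.1 (hN (s + j))
    · simpa [h] using ih
    · have hwindow : ∑ r ∈ Finset.Ico s (s + j), N r ≤ ∑ r ∈ Finset.Ico (s + j - τ) (s + j), N r :=
        Finset.sum_le_sum_of_subset (Finset.Ico_subset_Ico_left (by omega))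
      have hpos := fourthRoot_pos (Nat.succ_pos (∑ r ∈ Finset.Ico s (s + j), N r))
      have hterm : 1 / fourthRoot (∑ r ∈ Finset.Ico (s + j - τ) (s + j), N r + 1) ^ 3
          ≤ 1 / fourthRoot (∑ r ∈ Finset.Ico s (s + j), N r + 1) ^ 3 :=
        one_div_le_one_div_of_le (pow_pos hpos 3)
          (pow_le_pow_left₀ hpos.le (fourthRoot_mono (Nat.add_le_add_right hwindow 1)) 3)
      rw [h, Nat.cast_one, one_mul]
      linarith [one_div_fourthRoot_pow_le (∑ r ∈ Finset.Ico s (s + j), N r)]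

theorem sum_range_le_of_sum_Ico_le {f : ℕ → ℝ} (hf : ∀ t, 0 ≤ f t) {τ T : ℕ} (hτ : 0 < τ)
    (hτT : τ ≤ T) {c : ℝ} (hc : 0 ≤ c) (hblock : ∀ s, ∑ t ∈ Finset.Ico s (s + τ), f t ≤ c * τ) :
    ∑ t ∈ Finset.range T, f t ≤ 2 * c * T := by
  have hblocks (e : ℕ) : ∑ t ∈ Finset.range (e * τ), f t ≤ c * (e * τ : ℕ) := by
    induction e with
    | zero => simp
    | succ e ih =>
      rw [Nat.add_mul, one_mul, ← Finset.sum_range_add_sum_Ico _ (Nat.le_add_right (e * τ) τ),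
        Nat.cast_add, mul_add]
      exact add_le_add ih (hblock _)
  have hlower : T ≤ (T / τ + 1) * τ := ((Nat.div_lt_iff_lt_mul hτ).1 (Nat.lt_succ_self _)).le
  have hupper : (T / τ + 1) * τ ≤ 2 * T := by
    have := Nat.div_mul_le_self T τ
    rw [Nat.add_mul]
    omega
  calc ∑ t ∈ Finset.range T, f t ≤ ∑ t ∈ Finset.range ((T / τ + 1) * τ), f t :=
        Finset.sum_le_sum_of_subset_of_nonneg (Finset.range_mono hlower) fun t _ _ => hf t
    _ ≤ c * ((T / τ + 1) * τ : ℕ) := hblocks _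
    _ ≤ c * (2 * T : ℕ) := by gcongr
    _ = 2 * c * T := by push_cast; ring

variable {ι : Type*} [Fintype ι] {N : ι → ℕ → ℕ} {τ T : ℕ} {ρ : ℝ}

theorem sum_block_div_fourthRoot_window_le (hN : ∀ t, ∑ k, N k t ≤ 1) (hρ : 0 < ρ) (s : ℕ) :
    ∑ t ∈ Finset.Ico s (s + τ), ∑ k,
      (N k t : ℝ) * (ρ / fourthRoot (∑ r ∈ Finset.Ico (t - τ) t, N k r + 1) ^ 3)
      ≤ 4 * (Fintype.card ι * ρ ^ 2 + τ / ρ ^ 2) := by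
  have hN1 (k : ι) (t : ℕ) : N k t ≤ 1 :=
    (Finset.single_le_sum (fun _ _ => Nat.zero_le _) (Finset.mem_univ k)).trans (hN t)
  have htotal : ∑ k, ∑ t ∈ Finset.Ico s (s + τ), N k t ≤ τ := by
    rw [Finset.sum_comm]
    simpa using Finset.sum_le_card_nsmul (Finset.Ico s (s + τ)) _ 1 fun t _ => hN t
  rw [Finset.sum_comm]
  calc ∑ k, ∑ t ∈ Finset.Ico s (s + τ),
        (N k t : ℝ) * (ρ / fourthRoot (∑ r ∈ Finset.Ico (t - τ) t, N k r + 1) ^ 3)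
      = ∑ k, ρ * ∑ t ∈ Finset.Ico s (s + τ),
        (N k t : ℝ) * (1 / fourthRoot (∑ r ∈ Finset.Ico (t - τ) t, N k r + 1) ^ 3) := by
        simp only [Finset.mul_sum]
        exact Finset.sum_congr rfl fun k _ => Finset.sum_congr rfl fun t _ => by ring
    _ ≤ ∑ k, ρ * (4 * fourthRoot (∑ t ∈ Finset.Ico s (s + τ), N k t)) := by
        gcongr with k _
        exact sum_div_fourthRoot_window_le (hN1 k) le_rfl s
    _ ≤ ∑ k, 4 * (ρ ^ 2 + (∑ t ∈ Finset.Ico s (s + τ), N k t : ℕ) / ρ ^ 2) := by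
        refine Finset.sum_le_sum fun k _ => ?_
        rw [mul_left_comm]
        exact mul_le_mul_of_nonneg_left (mul_fourthRoot_le hρ _) zero_le_four
    _ = 4 * (Fintype.card ι * ρ ^ 2
        + (∑ k, ∑ t ∈ Finset.Ico s (s + τ), N k t : ℕ) / ρ ^ 2) := by
        rw [← Finset.mul_sum, Finset.sum_add_distrib, ← Finset.sum_div, ← Nat.cast_sum,
          Finset.sum_const, Finset.card_univ, nsmul_eq_mul]
    _ ≤ 4 * (Fintype.card ι * ρ ^ 2 + τ / ρ ^ 2) := by gcongr

theorem sum_slack_window_le (hN : ∀ t, ∑ k, N k t ≤ 1) (hρ : 0 < ρ)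
    (hρ4 : ρ ^ 4 = (τ : ℝ) / Fintype.card ι) (hτT : τ ≤ T) :
    ∑ t ∈ Finset.range T, ∑ k, (N k t : ℝ)
      * slack ρ (fourthRoot (∑ r ∈ Finset.Ico (t - τ) t, N k r + 1)) ≤ 17 * (T / ρ ^ 2) := by
  have hratio : (τ : ℝ) ≠ 0 ∧ (Fintype.card ι : ℝ) ≠ 0 :=
    div_ne_zero_iff.1 (hρ4 ▸ (pow_pos hρ 4).ne')
  have hτ : 0 < τ := Nat.pos_of_ne_zero (Nat.cast_ne_zero.1 hratio.1)
  have hcard : (Fintype.card ι : ℝ) * ρ ^ 4 = τ := by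
    rw [hρ4, mul_div_cancel₀ _ hratio.2]
  have hcube : ∑ t ∈ Finset.range T, ∑ k,
      (N k t : ℝ) * (ρ / fourthRoot (∑ r ∈ Finset.Ico (t - τ) t, N k r + 1) ^ 3)
      ≤ 2 * (8 / ρ ^ 2) * T := by
    refine sum_range_le_of_sum_Ico_le (fun t => Finset.sum_nonneg fun k _ => ?_) hτ hτT
      (by positivity) fun s => (sum_block_div_fourthRoot_window_le hN hρ s).trans_eq ?_
    · have := fourthRoot_nonneg (∑ r ∈ Finset.Ico (t - τ) t, N k r + 1)
      positivity
    · rw [← hcard]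
      field_simp
      ring
  have hconst : ∑ t ∈ Finset.range T, ∑ k, (N k t : ℝ) * (1 / ρ ^ 2) ≤ T * (1 / ρ ^ 2) := by
    simp only [← Finset.sum_mul]
    gcongr
    exact_mod_cast (Finset.sum_le_card_nsmul (Finset.range T) _ 1 fun t _ => hN t).trans_eq
      (by simp)
  simp only [slack, mul_add, Finset.sum_add_distrib]
  calc _ ≤ 2 * (8 / ρ ^ 2) * T + T * (1 / ρ ^ 2) := add_le_add hcube hconst
    _ = 17 * (T / ρ ^ 2) := by ring

theorem sum_sum_Ico_sub_le {f : ℕ → ℝ} (hf : ∀ r, 0 ≤ f r) (τ T : ℕ) :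
    ∑ t ∈ Finset.range T, ∑ r ∈ Finset.Ico (t - τ) t, f r ≤ τ * ∑ r ∈ Finset.range T, f r := by
  have hswap : ∑ t ∈ Finset.range T, ∑ r ∈ Finset.Ico (t - τ) t, f r
      = ∑ r ∈ Finset.range T, ∑ _t ∈ Finset.Ioc r (r + τ) ∩ Finset.range T, f r := by
    refine Finset.sum_comm' fun t r => ?_
    simp only [Finset.mem_range, Finset.mem_Ico, Finset.mem_inter, Finset.mem_Ioc]
    omega
  rw [hswap, Finset.mul_sum]
  gcongr with r _
  rw [Finset.sum_const, nsmul_eq_mul]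
  refine mul_le_mul_of_nonneg_right (Nat.cast_le.2 ?_) (hf r)
  exact (Finset.card_le_card Finset.inter_subset_left).trans_eq (by simp)

end Windows

/-! ### Variation of the means -/

section Drift

variable {K T : ℕ} {ν : Environment K T} {k : Fin K}

/-- The largest change of a mean reward from slot `r` to slot `r + 1`, and `0` at the last slot. -/
def drift (ν : Environment K T) (r : ℕ) : ℝ :=
  if h : r + 1 < T then
    ⨆ k : Fin K, |ν.mean ⟨r + 1, h⟩ k - ν.mean ⟨r, Nat.lt_of_succ_lt h⟩ k| else 0

theorem drift_nonneg (ν : Environment K T) (r : ℕ) : 0 ≤ drift ν r := by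
  unfold drift
  split_ifs
  · exact Real.iSup_nonneg fun k => abs_nonneg _
  · exact le_rfl

theorem sum_drift (ν : Environment K T) : ∑ r ∈ Finset.range T, drift ν r = ν.variation :=
  (Fin.sum_univ_eq_sum_range (drift ν) T).symm

theorem abs_mean_sub_mean_le_sum_drift {s t : ℕ} (hst : s ≤ t) (ht : t < T) :
    |ν.mean ⟨t, ht⟩ k - ν.mean ⟨s, hst.trans_lt ht⟩ k| ≤ ∑ r ∈ Finset.Ico s t, drift ν r := by
  induction t, hst using Nat.le_induction with
  | base => simp
  | succ t hst ih =>
    have hstep : |ν.mean ⟨t + 1, ht⟩ k - ν.mean ⟨t, by omega⟩ k| ≤ drift ν t := by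
      rw [drift, dif_pos ht]
      exact le_ciSup (f := fun k => |ν.mean ⟨t + 1, ht⟩ k - ν.mean ⟨t, by omega⟩ k|)
        (Set.finite_range _).bddAbove k
    rw [Finset.sum_Ico_succ_top hst]
    linarith [ih (by omega), abs_sub_le (ν.mean ⟨t + 1, ht⟩ k) (ν.mean ⟨t, by omega⟩ k)
      (ν.mean ⟨s, by omega⟩ k)]

/-- The change of the means within the window of length `τ` before slot `t`. -/
def windowDrift (ν : Environment K T) (τ t : ℕ) : ℝ := ∑ r ∈ Finset.Ico (t - τ) t, drift ν r

theorem windowDrift_nonneg (ν : Environment K T) (τ t : ℕ) : 0 ≤ windowDrift ν τ t :=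
  Finset.sum_nonneg fun r _ => drift_nonneg ν r

theorem sum_windowDrift_le (ν : Environment K T) (τ : ℕ) :
    ∑ t ∈ Finset.range T, windowDrift ν τ t ≤ τ * ν.variation :=
  (sum_sum_Ico_sub_le (drift_nonneg ν) τ T).trans_eq (by rw [sum_drift])

theorem abs_integral_sat_sub_mean_le_windowDrift (hν : ν.HeavyTailed) {B : ℝ} (hB : 0 < B)
    {s t τ : ℕ} (hst : s < t) (ht : t < T) (hτ : t ≤ s + τ) :
    |∫ z, sat z B ∂(ν ⟨s, hst.trans ht⟩ k : Measure ℝ) - ν.mean ⟨t, ht⟩ k|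
      ≤ windowDrift ν τ t + 1 / B := by
  have hdrift : |ν.mean ⟨s, hst.trans ht⟩ k - ν.mean ⟨t, ht⟩ k| ≤ windowDrift ν τ t := by
    rw [abs_sub_comm]
    exact (abs_mean_sub_mean_le_sum_drift hst.le ht).trans (Finset.sum_le_sum_of_subset_of_nonneg
      (Finset.Ico_subset_Ico_left (by omega)) fun r _ _ => drift_nonneg ν r)
  rw [add_comm]
  exact (abs_sub_le _ _ _).trans
    (add_le_add (hν.abs_integral_sat_sub_mean_le hB ⟨s, hst.trans ht⟩ k) hdrift)

end Drift

/-! ### The index along a run -/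

section Run

variable {K T : ℕ} {π : Policy K} {ν : Environment K T} {k : Fin K} {τ t : ℕ}

theorem sum_windowSlots_eq_sum_Ico {M : Type*} [AddCommMonoid M] (H : Fin t → Fin K × ℝ)
    {F : Fin t → M} {G : ℕ → M} (h : ∀ s : Fin t, G s = if (H s).1 = k then F s else 0) :
    ∑ s ∈ windowSlots τ H k, F s = ∑ s ∈ Finset.Ico (t - τ) t, G s := by
  have hfilter : Finset.Ico (t - τ) t = {s ∈ Finset.range t | t ≤ s + τ} := by
    ext s
    simp only [Finset.mem_Ico, Finset.mem_filter, Finset.mem_range]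
    omega
  rw [hfilter, Finset.sum_filter, ← Fin.sum_univ_eq_sum_range (fun s => if t ≤ s + τ then G s
    else 0), windowSlots, ← Finset.filter_filter, Finset.sum_filter, Finset.sum_filter]
  simp only [h]

theorem card_windowSlots_history (ht : t ≤ T) (x : Fin T → Fin K → ℝ) :
    (windowSlots τ (π.history x t ht) k).card = pullCount π k (t - τ) t x := by
  rw [Finset.card_eq_sum_ones]
  refine sum_windowSlots_eq_sum_Ico _ fun s => ?_
  rw [π.history_apply, pulled, dif_pos (s.isLt.trans_le ht)]

theorem noiseSum_eq_sum_windowSlots (B : ℝ) (ht : t ≤ T) (x : Fin T → Fin K → ℝ) :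
    noiseSum π ν B k (t - τ) t x = ∑ s ∈ windowSlots τ (π.history x t ht) k,
      (sat (π.history x t ht s).2 B
        - ∫ z, sat z B ∂(ν ⟨s, s.isLt.trans_le ht⟩ k : Measure ℝ)) := by
  refine (sum_windowSlots_eq_sum_Ico _ fun s => ?_).symm
  rw [π.history_apply, noise, dif_pos (s.isLt.trans_le ht)]
  refine if_ctx_congr Iff.rfl (fun h => ?_) fun _ => rfl
  simp only at h
  rw [h]

theorem abs_satMean_sub_le (hν : ν.HeavyTailed) {a : ℝ} (ha : 1 < a) (ht : t < T)
    (x : Fin T → Fin K → ℝ) (hn : 0 < pullCount π k (t - τ) t x) :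
    |satMean a τ (π.history x t ht.le) k
      - noiseSum π ν (levelLimit a K τ (level a (pullCount π k (t - τ) t x))) k (t - τ) t x
        / pullCount π k (t - τ) t x - ν.mean ⟨t, ht⟩ k|
      ≤ windowDrift ν τ t + 1 / levelLimit a K τ (level a (pullCount π k (t - τ) t x)) := by
  have hcard := card_windowSlots_history (τ := τ) (k := k) (π := π) ht.le x
  rw [satMean, noiseSum_eq_sum_windowSlots _ ht.le x, satLimit_eq_levelLimit, ← hcard]
  rw [← hcard] at hn
  set W := windowSlots τ (π.history x t ht.le) k with hW
  set B := levelLimit a K τ (level a W.card)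
  have hcard0 : (0 : ℝ) < W.card := Nat.cast_pos.2 hn
  have hmean : 1 / (W.card : ℝ) * ∑ s ∈ W, sat (π.history x t ht.le s).2 B
      - (∑ s ∈ W, (sat (π.history x t ht.le s).2 B
        - ∫ z, sat z B ∂(ν ⟨s, s.isLt.trans ht⟩ k : Measure ℝ))) / W.card - ν.mean ⟨t, ht⟩ k
      = (∑ s ∈ W, (∫ z, sat z B ∂(ν ⟨s, s.isLt.trans ht⟩ k : Measure ℝ)
        - ν.mean ⟨t, ht⟩ k)) / W.card := by
    rw [Finset.sum_sub_distrib, Finset.sum_sub_distrib, Finset.sum_const, nsmul_eq_mul]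
    field_simp
    ring
  rw [hmean, abs_div, abs_of_pos hcard0, div_le_iff₀ hcard0, mul_comm, ← nsmul_eq_mul]
  refine (Finset.abs_sum_le_sum_abs _ _).trans (Finset.sum_le_card_nsmul _ _ _ fun s hs => ?_)
  exact abs_integral_sat_sub_mean_le_windowDrift hν (levelLimit_pos ha _) s.isLt ht
    (Finset.mem_filter.1 hs).2.1

end Run

/-! ### The loss of a single slot -/

section Loss

variable {K T : ℕ} {π : Policy K} {ν : Environment K T} {a ζ ρ q : ℝ} {τ t : ℕ} {k : Fin K}

/-- The exponential supermartingale, at level `l`, that bounds how far the index of arm `k` lies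
below its mean reward at slot `t`. -/
def lowerTerm (a ζ : ℝ) (τ : ℕ) (π : Policy K) (ν : Environment K T) (k : Fin K) (t l : ℕ)
    (x : Fin T → Fin K → ℝ) : ℝ :=
  Real.exp (-expParam a ζ (levelLimit a K τ l)
      * noiseSum π ν (levelLimit a K τ l) k (t - τ) t x
    - expRate (2 * levelLimit a K τ l) (expParam a ζ (levelLimit a K τ l))
      * pullCount π k (t - τ) t x)

/-- The fourth power that bounds how far the index of arm `k` lies above its mean reward at
slot `t`, if the window has no more samples than level `l` allows. -/
def upperTerm (a : ℝ) (τ : ℕ) (π : Policy K) (ν : Environment K T) (k : Fin K) (t l : ℕ)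
    (x : Fin T → Fin K → ℝ) : ℝ :=
  if pullCount π k (t - τ) t x ≤ ⌈a ^ l⌉₊ then
    noiseSum π ν (levelLimit a K τ l) k (t - τ) t x ^ 4 else 0

/-- The factor of `upperTerm`, where `q ^ 4 = a` and `ρ ^ 4 = τ / K`. -/
def upperCoeff (a ρ q : ℝ) (l : ℕ) : ℝ := a ^ 4 / ((a ^ l) ^ 4 * slack ρ (q ^ l) ^ 3)

theorem upperTerm_nonneg (a : ℝ) (τ : ℕ) (t l : ℕ) (x : Fin T → Fin K → ℝ) :
    0 ≤ upperTerm a τ π ν k t l x := by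
  unfold upperTerm
  split_ifs <;> positivity

theorem upperCoeff_nonneg (ha : 0 < a) (hρ : 0 < ρ) (hq : 0 < q) (l : ℕ) :
    0 ≤ upperCoeff a ρ q l := by
  have := slack_pos hρ (pow_pos hq l)
  unfold upperCoeff
  positivity

theorem expCoeff_levelLimit_nonneg (ha : 1 < a) (hζ : 0 < ζ) (l : ℕ) :
    0 ≤ expCoeff a ζ (levelLimit a K τ l) (a ^ l) :=
  expCoeff_nonneg (one_pos.trans ha) hζ (levelLimit_pos ha l) (by positivity)

theorem sum_expCoeff_mul_lowerTerm_nonneg (ha : 1 < a) (hζ : 0 < ζ) (n : ℕ)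
    (x : Fin T → Fin K → ℝ) :
    0 ≤ ∑ l ∈ Finset.range n,
      expCoeff a ζ (levelLimit a K τ l) (a ^ l) * lowerTerm a ζ τ π ν k t l x :=
  Finset.sum_nonneg fun l _ => mul_nonneg (expCoeff_levelLimit_nonneg ha hζ l) (Real.exp_pos _).le

theorem sum_upperCoeff_mul_upperTerm_nonneg (ha : 0 < a) (hρ : 0 < ρ) (hq : 0 < q) (n : ℕ)
    (x : Fin T → Fin K → ℝ) :
    0 ≤ ∑ l ∈ Finset.range n, upperCoeff a ρ q l * upperTerm a τ π ν k t l x :=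
  Finset.sum_nonneg fun l _ => mul_nonneg (upperCoeff_nonneg ha hρ hq l)
    (upperTerm_nonneg a τ t l x)

theorem level_pullCount_mem_range (ha : 1 < a) (ht : t ≤ T) (x : Fin T → Fin K → ℝ)
    (hn : 0 < pullCount π k (t - τ) t x) :
    level a (pullCount π k (t - τ) t x) ∈ Finset.range (level a T + 1) := by
  have hle : pullCount π k (t - τ) t x ≤ t - (t - τ) := by
    simpa [pullCount] using
      Finset.sum_le_card_nsmul (Finset.Ico (t - τ) t) _ 1 fun s _ => pulled_le_one s x
  exact Finset.mem_range.2 (Nat.lt_succ_of_le (level_mono ha hn (by omega)))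

theorem mean_sub_index_le (hν : ν.HeavyTailed) (ha : 1 < a) (hζ : 0 < ζ) (hK : 0 < K)
    (hτ : 0 < τ) (ht : t < T) (x : Fin T → Fin K → ℝ)
    (hn : 0 < pullCount π k (t - τ) t x) :
    ν.mean ⟨t, ht⟩ k - (satMean a τ (π.history x t ht.le) k
        + (1 + ζ) * radius K τ (pullCount π k (t - τ) t x))
      ≤ windowDrift ν τ t + ∑ l ∈ Finset.range (level a T + 1),
        expCoeff a ζ (levelLimit a K τ l) (a ^ l) * lowerTerm a ζ τ π ν k t l x := by
  have hsatMean := (abs_le.1 (abs_satMean_sub_le hν ha ht x hn)).1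
  have hlevel := Finset.single_le_sum
    (f := fun l => expCoeff a ζ (levelLimit a K τ l) (a ^ l) * lowerTerm a ζ τ π ν k t l x)
    (fun l _ => mul_nonneg (expCoeff_levelLimit_nonneg ha hζ l) (Real.exp_pos _).le)
    (level_pullCount_mem_range ha ht.le x hn)
  set n := pullCount π k (t - τ) t x with hndef
  have hnoise := neg_div_sub_le_expCoeff_mul
    (noiseSum π ν (levelLimit a K τ (level a n)) k (t - τ) t x) (one_pos.trans ha) hζ
    (levelLimit_pos (K := K) (τ := τ) ha (level a n)) (Nat.cast_pos.2 hn) (lt_pow_level ha hn)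
    (pow_level_le ha hn)
  have hradius : (1 + ζ) * (1 / levelLimit a K τ (level a n)) ≤ (1 + ζ) * radius K τ n :=
    mul_le_mul_of_nonneg_left (inv_levelLimit_le_radius ha hK hτ hn) (by linarith)
  have hsplit : (1 + ζ) * (1 / levelLimit a K τ (level a n))
      = 1 / levelLimit a K τ (level a n) + ζ / levelLimit a K τ (level a n) := by ring
  simp only [lowerTerm, ← hndef] at hlevel ⊢
  linarith

theorem noiseSum_div_le (ha : 1 < a) (hq : 0 < q) (hqa : q ^ 4 = a) (hρ : 0 < ρ) {n : ℕ}
    (x : Fin T → Fin K → ℝ) (hcount : pullCount π k (t - τ) t x = n) (hn : 0 < n) :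
    noiseSum π ν (levelLimit a K τ (level a n)) k (t - τ) t x / n
      ≤ slack ρ (fourthRoot n)
        + upperCoeff a ρ q (level a n) * upperTerm a τ π ν k t (level a n) x := by
  have hH := lt_pow_level ha hn
  have hQ : 0 < q ^ level a n := pow_pos hq _
  have hroot : fourthRoot n ≤ q ^ level a n := by
    refine le_of_pow_le_pow_left₀ (n := 4) (by norm_num) hQ.le ?_
    rw [fourthRoot_pow, ← pow_mul, mul_comm, pow_mul, hqa]
    exact hH.le
  have hupper : upperTerm a τ π ν k t (level a n) x
      = noiseSum π ν (levelLimit a K τ (level a n)) k (t - τ) t x ^ 4 := by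
    rw [upperTerm, hcount, if_pos]
    exact_mod_cast hH.le.trans (Nat.le_ceil _)
  rw [hupper, upperCoeff]
  exact (div_le_add_mul_pow_four (Nat.cast_pos.2 hn) hH (pow_level_le ha hn)
    (slack_pos hρ hQ)).trans
      (add_le_add_left (slack_anti hρ (fourthRoot_pos hn) hroot) _)

theorem index_sub_mean_le (hν : ν.HeavyTailed) (ha : 1 < a) (hζ : 0 < ζ) (hq : 0 < q)
    (hqa : q ^ 4 = a) (hK : 0 < K) (hτ : 0 < τ) (hρ : 0 < ρ) (hρ4 : ρ ^ 4 = (τ : ℝ) / K)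
    (ht : t < T) (x : Fin T → Fin K → ℝ) (hn : 0 < pullCount π k (t - τ) t x) :
    satMean a τ (π.history x t ht.le) k
        + (1 + ζ) * radius K τ (pullCount π k (t - τ) t x) - ν.mean ⟨t, ht⟩ k
      ≤ windowDrift ν τ t
        + 8 * (7 + 3 * ζ) * slack ρ (fourthRoot (pullCount π k (t - τ) t x + 1))
        + ∑ l ∈ Finset.range (level a T + 1),
            upperCoeff a ρ q l * upperTerm a τ π ν k t l x := by
  have hsatMean := (abs_le.1 (abs_satMean_sub_le hν ha ht x hn)).2
  have hlevel := Finset.single_le_sum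
    (f := fun l => upperCoeff a ρ q l * upperTerm a τ π ν k t l x)
    (fun l _ => mul_nonneg (upperCoeff_nonneg (by linarith) hρ hq l) (upperTerm_nonneg a τ t l x))
    (level_pullCount_mem_range ha ht.le x hn)
  set n := pullCount π k (t - τ) t x with hndef
  have hnoise := noiseSum_div_le (ν := ν) ha hq hqa hρ x hndef.symm hn
  have hlimit := inv_levelLimit_le_radius (K := K) (τ := τ) ha hK hτ hn
  have hradius : (2 + ζ) * radius K τ n ≤ (2 + ζ) * (3 * slack ρ (fourthRoot n)) :=
    mul_le_mul_of_nonneg_left (radius_le_slack hρ (fourthRoot_pos hn) hρ4 (fourthRoot_pow n))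
      (by linarith)
  have hslack : (7 + 3 * ζ) * slack ρ (fourthRoot n)
      ≤ (7 + 3 * ζ) * (8 * slack ρ (fourthRoot (n + 1))) :=
    mul_le_mul_of_nonneg_left (slack_le_eight_mul hρ (fourthRoot_pos hn)
      (fourthRoot_pos n.succ_pos) (fourthRoot_succ_le hn)) (by linarith)
  linarith

theorem IsSWRMOSS.index_le_index_arm (hπ : IsSWRMOSS a ζ τ π) (t : Fin T)
    (x : Fin T → Fin K → ℝ) (hn : 0 < pullCount π (π.arm x t) (t - τ) t x) (j : Fin K) :
    0 < pullCount π j (t - τ) t x ∧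
      satMean a τ (π.history x t t.isLt.le) j
          + (1 + ζ) * radius K τ (pullCount π j (t - τ) t x)
        ≤ satMean a τ (π.history x t t.isLt.le) (π.arm x t)
          + (1 + ζ) * radius K τ (pullCount π (π.arm x t) (t - τ) t x) := by
  have hcard (k : Fin K) : (windowSlots τ (π.history x t t.isLt.le) k).card
      = pullCount π k (t - τ) t x := card_windowSlots_history t.isLt.le x
  have hKt : K ≤ t := by
    by_contra! hlt
    obtain ⟨s, hs⟩ := Finset.card_pos.1 (hn.trans_eq (hcard _).symm)
    exact hπ.initial t hlt (π.history x t t.isLt.le) s (Finset.mem_filter.1 hs).2.2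
  have hmax : ucbIndex a ζ τ _ j ≤ ucbIndex a ζ τ _ (π.arm x t) :=
    hπ.maximal t hKt (π.history x t t.isLt.le) j
  simp only [ucbIndex, hcard, if_neg hn.ne'] at hmax
  rcases Nat.eq_zero_or_pos (pullCount π j (t - τ) t x) with hj | hj
  · rw [if_pos hj] at hmax
    exact absurd (top_le_iff.1 hmax) (EReal.coe_ne_top _)
  · rw [if_neg hj.ne', EReal.coe_le_coe_iff] at hmax
    exact ⟨hj, hmax⟩

theorem one_le_slack_one (hρ : 1 ≤ ρ) : 1 ≤ slack ρ 1 := by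
  unfold slack
  simpa using hρ.trans (le_add_of_nonneg_right (by positivity))

theorem loss_le (hν : ν.HeavyTailed) (ha : 1 < a) (hζ : 0 < ζ) (hq : 0 < q) (hqa : q ^ 4 = a)
    (hK : 0 < K) (hτ : 0 < τ) (hρ : 1 ≤ ρ) (hρ4 : ρ ^ 4 = (τ : ℝ) / K)
    (hπ : IsSWRMOSS a ζ τ π) (t : Fin T) (x : Fin T → Fin K → ℝ) {j : Fin K}
    (hj : ν.mean t j = ν.bestMean t) :
    ν.bestMean t - ν.mean t (π.arm x t) ≤ 2 * windowDrift ν τ t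
      + 8 * (7 + 3 * ζ) * slack ρ (fourthRoot (pullCount π (π.arm x t) (t - τ) t x + 1))
      + ∑ l ∈ Finset.range (level a T + 1),
          expCoeff a ζ (levelLimit a K τ l) (a ^ l) * lowerTerm a ζ τ π ν j t l x
      + ∑ l ∈ Finset.range (level a T + 1),
          upperCoeff a ρ q l * upperTerm a τ π ν (π.arm x t) t l x := by
  have hρ0 : 0 < ρ := one_pos.trans_le hρ
  rcases Nat.eq_zero_or_pos (pullCount π (π.arm x t) (t - τ) t x) with hn | hn
  · have hlower := sum_expCoeff_mul_lowerTerm_nonneg (τ := τ) (t := t) (π := π) (ν := ν) (k := j)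
      ha hζ (level a T + 1) x
    have hupper := sum_upperCoeff_mul_upperTerm_nonneg (τ := τ) (t := t) (π := π) (ν := ν)
      (k := π.arm x t) (one_pos.trans ha) hρ0 hq (level a T + 1) x
    have hdrift := windowDrift_nonneg ν τ t
    have hloss := hν.bestMean_sub_mean_le_two hK t (π.arm x t)
    rw [hn, zero_add, fourthRoot_one]
    nlinarith [one_le_slack_one hρ]
  · obtain ⟨hnj, hindex⟩ := hπ.index_le_index_arm t x hn j
    have hlower := mean_sub_index_le hν ha hζ hK hτ t.isLt x hnj
    have hupper := index_sub_mean_le hν ha hζ hq hqa hK hτ hρ0 hρ4 t.isLt x hn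
    rw [Fin.eta] at hlower hupper
    linarith

end Loss

/-! ### The regret -/

section RegretBound

variable {K T : ℕ} {π : Policy K} {ν : Environment K T} {a ζ ρ q V : ℝ} {τ : ℕ}

theorem sum_arm_eq_sum_pulled (f : Fin K → ℕ → ℝ) (x : Fin T → Fin K → ℝ) :
    ∑ t : Fin T, f (π.arm x t) t
      = ∑ t ∈ Finset.range T, ∑ k, (pulled π k t x : ℝ) * f k t := by
  rw [← Fin.sum_univ_eq_sum_range fun t => ∑ k, (pulled π k t x : ℝ) * f k t]
  refine Finset.sum_congr rfl fun t _ => ?_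
  simp [pulled]

theorem lowerTerm_eq_exp_sum (k : Fin K) (t l : ℕ) :
    lowerTerm a ζ τ π ν k t l = fun x => Real.exp (-expParam a ζ (levelLimit a K τ l)
        * ∑ s ∈ Finset.Ico (t - τ) t, noise π ν (levelLimit a K τ l) k s x
      - expRate (2 * levelLimit a K τ l) (expParam a ζ (levelLimit a K τ l))
        * ∑ s ∈ Finset.Ico (t - τ) t, (pulled π k s x : ℝ)) := by
  simp only [funext_iff, lowerTerm, noiseSum, pullCount, Nat.cast_sum, implies_true]

theorem integrable_lowerTerm (hπ : ∀ t, Measurable (π t)) (hν : ν.HeavyTailed) (ha : 1 < a)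
    (k : Fin K) (t l : ℕ) : Integrable (lowerTerm a ζ τ π ν k t l) ν.rewardLaw := by
  rw [lowerTerm_eq_exp_sum]
  exact integrable_of_mem_boundedMeasurable ((pastRewards K T).le t)
    ((isNoise_noise hπ hν (levelLimit_pos ha l).le k).exp_mem_boundedMeasurable _ _ _ t)

theorem integral_lowerTerm_le_one (hπ : ∀ t, Measurable (π t)) (hν : ν.HeavyTailed) (ha : 1 < a)
    (hζ : 0 < ζ) (k : Fin K) (t l : ℕ) :
    ∫ x, lowerTerm a ζ τ π ν k t l x ∂ν.rewardLaw ≤ 1 := by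
  have hB := levelLimit_pos (K := K) (τ := τ) ha l
  rw [lowerTerm_eq_exp_sum]
  exact (isNoise_noise hπ hν hB.le k).integral_exp_le_one (by positivity)
    (expParam_pos (one_pos.trans ha) hζ hB) (Nat.sub_le t τ)

theorem integrable_sum_lowerTerm (hπ : ∀ t, Measurable (π t)) (hν : ν.HeavyTailed) (ha : 1 < a)
    (j : Fin T → Fin K) (n : ℕ) :
    Integrable (fun x => ∑ t : Fin T, ∑ l ∈ Finset.range n,
      expCoeff a ζ (levelLimit a K τ l) (a ^ l) * lowerTerm a ζ τ π ν (j t) t l x) ν.rewardLaw :=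
  integrable_finsetSum _ fun t _ => integrable_finsetSum _ fun l _ =>
    (integrable_lowerTerm hπ hν ha (j t) t l).const_mul _

theorem integral_sum_lowerTerm_le (hπ : ∀ t, Measurable (π t)) (hν : ν.HeavyTailed) (ha : 1 < a)
    (hζ : 0 < ζ) (j : Fin T → Fin K) (n : ℕ) :
    ∫ x, ∑ t : Fin T, ∑ l ∈ Finset.range n,
        expCoeff a ζ (levelLimit a K τ l) (a ^ l) * lowerTerm a ζ τ π ν (j t) t l x ∂ν.rewardLaw
      ≤ T * ∑ l ∈ Finset.range n, expCoeff a ζ (levelLimit a K τ l) (a ^ l) := by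
  have hint (t : Fin T) (l : ℕ) := (integrable_lowerTerm (ζ := ζ) (τ := τ) hπ hν ha (j t) t
    l).const_mul (expCoeff a ζ (levelLimit a K τ l) (a ^ l))
  calc _ = ∑ t : Fin T, ∑ l ∈ Finset.range n, expCoeff a ζ (levelLimit a K τ l) (a ^ l)
        * ∫ x, lowerTerm a ζ τ π ν (j t) t l x ∂ν.rewardLaw := by
        rw [integral_finsetSum _ fun t _ => integrable_finsetSum _ fun l _ => hint t l]
        refine Finset.sum_congr rfl fun t _ => ?_
        rw [integral_finsetSum _ fun l _ => hint t l]
        exact Finset.sum_congr rfl fun l _ => integral_const_mul _ _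
    _ ≤ ∑ _t : Fin T, ∑ l ∈ Finset.range n, expCoeff a ζ (levelLimit a K τ l) (a ^ l) :=
        Finset.sum_le_sum fun t _ => Finset.sum_le_sum fun l _ =>
          mul_le_of_le_one_right (expCoeff_levelLimit_nonneg ha hζ l)
            (integral_lowerTerm_le_one hπ hν ha hζ (j t) t l)
    _ = _ := by simp

theorem integrable_pulled (hπ : ∀ t, Measurable (π t)) (hν : ν.HeavyTailed) (k : Fin K) (t : ℕ) :
    Integrable (fun x => (pulled π k t x : ℝ)) ν.rewardLaw :=
  integrable_of_mem_boundedMeasurable ((pastRewards K T).le t)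
    ((isNoise_noise hπ hν le_rfl k).variance_mem t)

theorem sum_integral_sum_pulled (hπ : ∀ t, Measurable (π t)) (hν : ν.HeavyTailed) :
    ∑ k, ∫ x, ∑ t ∈ Finset.range T, (pulled π k t x : ℝ) ∂ν.rewardLaw = T := by
  rw [← integral_finsetSum _ fun k _ => integrable_finsetSum _ fun t _ =>
    integrable_pulled hπ hν k t]
  simp only [Finset.sum_comm (s := Finset.univ), ← Nat.cast_sum]
  have hone (x : Fin T → Fin K → ℝ) : ∑ t ∈ Finset.range T, ∑ k, pulled π k t x = T :=
    (Finset.sum_congr rfl fun t ht => sum_pulled_eq_one (Finset.mem_range.1 ht) x).trans (by simp)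
  simp [hone]

theorem integrable_pulled_mul_upperTerm (hπ : ∀ t, Measurable (π t)) (hν : ν.HeavyTailed)
    (ha : 1 < a) (k : Fin K) (t l : ℕ) :
    Integrable (fun x => (pulled π k t x : ℝ) * upperTerm a τ π ν k t l x) ν.rewardLaw := by
  have hnoise := isNoise_noise hπ hν (levelLimit_pos (K := K) (τ := τ) ha l).le k
  have hwindow : MeasurableSet[pastRewards K T t]
      {x | ∑ s ∈ Finset.Ico (t - τ) t, (pulled π k s x : ℝ) ≤ ⌈a ^ l⌉₊} :=
    (hnoise.sum_variance_mem_boundedMeasurable (t - τ) t).1 measurableSet_Iic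
  refine (integrable_of_mem_boundedMeasurable ((pastRewards K T).le t) (mul_mem
    (hnoise.variance_mem t) (indicator_mem_boundedMeasurable
      (pow_mem (hnoise.sum_mem_boundedMeasurable (t - τ) t) 4) hwindow))).congr
        (.of_forall fun x => ?_)
  simp only [upperTerm, noiseSum, pullCount, Pi.mul_apply, Set.indicator_apply,
    Set.mem_ofPred_eq, Pi.pow_apply, ← Nat.cast_sum, Nat.cast_le]
  congr

theorem integral_sum_pulled_mul_upperTerm_le (hπ : ∀ t, Measurable (π t)) (hν : ν.HeavyTailed)
    (ha : 1 < a) (k : Fin K) (l : ℕ) :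
    ∫ x, ∑ t ∈ Finset.range T, (pulled π k t x : ℝ) * upperTerm a τ π ν k t l x ∂ν.rewardLaw
      ≤ 48384 * (a ^ l) ^ 2
        * ∫ x, ∑ t ∈ Finset.range T, (pulled π k t x : ℝ) ∂ν.rewardLaw := by
  have hpow : 1 ≤ a ^ l := one_le_pow₀ ha.le
  have hceil : (⌈a ^ l⌉₊ : ℝ) ≤ 2 * a ^ l := by
    linarith [Nat.ceil_lt_add_one (zero_le_one.trans hpow)]
  have : 0 ≤ ∫ x, ∑ t ∈ Finset.range T, (pulled π k t x : ℝ) ∂ν.rewardLaw :=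
    integral_nonneg fun x => by positivity
  have hmoment := (isNoise_noise hπ hν (levelLimit_pos (K := K) (τ := τ) ha l).le
    k).integral_window_pow_four_le pulled_le_one (H := ⌈a ^ l⌉₊)
      (Nat.ceil_pos.2 (one_pos.trans_le hpow)) τ T
  calc _ ≤ 864 * ⌈a ^ l⌉₊ * (2 * (2 * levelLimit a K τ l) ^ 2 + 10 * ⌈a ^ l⌉₊)
        * ∫ x, ∑ t ∈ Finset.range T, (pulled π k t x : ℝ) ∂ν.rewardLaw := by
        simp only [upperTerm, mul_ite, mul_zero]
        exact hmoment
    _ ≤ 864 * (2 * a ^ l) * (2 * (4 * a ^ l) + 10 * (2 * a ^ l))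
        * ∫ x, ∑ t ∈ Finset.range T, (pulled π k t x : ℝ) ∂ν.rewardLaw := by
        gcongr
        linarith [levelLimit_sq_le (K := K) (τ := τ) ha l]
    _ = _ := by ring

theorem upperCoeff_mul_pow_le (ha : 0 < a) (hq : 0 < q) (hqa : q ^ 4 = a) (hρ : 0 < ρ) (l : ℕ) :
    upperCoeff a ρ q l * (a ^ l) ^ 2 ≤ a ^ 4 * (4 * bump (q ^ l * ρ⁻¹) / ρ ^ 2) := by
  have hQ : (q ^ l) ^ 8 = (a ^ l) ^ 2 := by
    rw [← hqa]
    ring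
  have hslack := slack_pos hρ (pow_pos hq l)
  calc upperCoeff a ρ q l * (a ^ l) ^ 2 = a ^ 4 * (1 / ((q ^ l) ^ 8 * slack ρ (q ^ l) ^ 3)) := by
        rw [hQ, upperCoeff]
        field_simp
    _ ≤ _ := mul_le_mul_of_nonneg_left (inv_slack_pow_le_bump (pow_pos hq l) hρ) (by positivity)

theorem sum_upperTerm_arm_eq (x : Fin T → Fin K → ℝ) (n : ℕ) :
    ∑ t : Fin T, ∑ l ∈ Finset.range n, upperCoeff a ρ q l * upperTerm a τ π ν (π.arm x t) t l x
      = ∑ l ∈ Finset.range n, upperCoeff a ρ q l * ∑ k, ∑ t ∈ Finset.range T,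
        (pulled π k t x : ℝ) * upperTerm a τ π ν k t l x := by
  rw [Finset.sum_comm]
  refine Finset.sum_congr rfl fun l _ => ?_
  rw [← Finset.mul_sum, sum_arm_eq_sum_pulled (fun k t => upperTerm a τ π ν k t l x),
    Finset.sum_comm]

theorem integrable_sum_upperTerm_arm (hπ : ∀ t, Measurable (π t)) (hν : ν.HeavyTailed)
    (ha : 1 < a) (n : ℕ) :
    Integrable (fun x => ∑ t : Fin T, ∑ l ∈ Finset.range n,
      upperCoeff a ρ q l * upperTerm a τ π ν (π.arm x t) t l x) ν.rewardLaw := by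
  simp only [sum_upperTerm_arm_eq]
  exact integrable_finsetSum _ fun l _ => (integrable_finsetSum _ fun k _ =>
    integrable_finsetSum _ fun t _ => integrable_pulled_mul_upperTerm hπ hν ha k t l).const_mul _

theorem integral_sum_upperTerm_arm_le (hπ : ∀ t, Measurable (π t)) (hν : ν.HeavyTailed)
    (ha : 1 < a) (hq : 1 < q) (hqa : q ^ 4 = a) (hρ : 0 < ρ) (n : ℕ) :
    ∫ x, ∑ t : Fin T, ∑ l ∈ Finset.range n,
        upperCoeff a ρ q l * upperTerm a τ π ν (π.arm x t) t l x ∂ν.rewardLaw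
      ≤ 48384 * a ^ 4 * (4 * (q / (q - 1))) * (T / ρ ^ 2) := by
  have ha0 : 0 < a := one_pos.trans ha
  have hq0 : 0 < q := one_pos.trans hq
  have hint (l : ℕ) (k : Fin K) := integrable_finsetSum (Finset.range T) fun t _ =>
    integrable_pulled_mul_upperTerm (τ := τ) hπ hν ha k t l
  calc _ = ∑ l ∈ Finset.range n, upperCoeff a ρ q l * ∑ k, ∫ x, ∑ t ∈ Finset.range T,
        (pulled π k t x : ℝ) * upperTerm a τ π ν k t l x ∂ν.rewardLaw := by
        simp only [sum_upperTerm_arm_eq]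
        rw [integral_finsetSum _ fun l _ =>
          (integrable_finsetSum _ fun k _ => hint l k).const_mul _]
        refine Finset.sum_congr rfl fun l _ => ?_
        rw [integral_const_mul, integral_finsetSum _ fun k _ => hint l k]
    _ ≤ ∑ l ∈ Finset.range n, upperCoeff a ρ q l * (48384 * (a ^ l) ^ 2 * T) := by
        refine Finset.sum_le_sum fun l _ =>
          mul_le_mul_of_nonneg_left ?_ (upperCoeff_nonneg ha0 hρ hq0 l)
        refine (Finset.sum_le_sum fun k _ =>
          integral_sum_pulled_mul_upperTerm_le hπ hν ha k l).trans_eq ?_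
        rw [← Finset.mul_sum, sum_integral_sum_pulled hπ hν]
    _ ≤ ∑ l ∈ Finset.range n, 48384 * T * (a ^ 4 * (4 * bump (q ^ l * ρ⁻¹) / ρ ^ 2)) := by
        refine Finset.sum_le_sum fun l _ => ?_
        refine le_of_eq_of_le (by ring)
          (mul_le_mul_of_nonneg_left (upperCoeff_mul_pow_le ha0 hq0 hqa hρ l) (by positivity))
    _ = 48384 * a ^ 4 * (4 * ∑ l ∈ Finset.range n, bump (q ^ l * ρ⁻¹)) * (T / ρ ^ 2) := by
        simp only [Finset.mul_sum, Finset.sum_mul]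
        exact Finset.sum_congr rfl fun l _ => by ring
    _ ≤ _ := by
        gcongr
        exact sum_bump_le hq (inv_pos.2 hρ) n

theorem sum_slack_arm_le (hτT : τ ≤ T) (hρ : 0 < ρ) (hρ4 : ρ ^ 4 = (τ : ℝ) / K)
    (x : Fin T → Fin K → ℝ) :
    ∑ t : Fin T, slack ρ (fourthRoot (pullCount π (π.arm x t) (t - τ) t x + 1))
      ≤ 17 * (T / ρ ^ 2) := by
  rw [sum_arm_eq_sum_pulled fun k t => slack ρ (fourthRoot (pullCount π k (t - τ) t x + 1))]
  refine sum_slack_window_le (fun t => ?_) hρ (by rw [hρ4, Fintype.card_fin]) hτT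
  rcases lt_or_ge t T with ht | ht
  · exact (sum_pulled_eq_one ht x).le
  · simp [pulled_eq_zero ht]

theorem sum_loss_le (hν : ν.HeavyTailed) (ha : 1 < a) (hζ : 0 < ζ) (hq : 0 < q) (hqa : q ^ 4 = a)
    (hK : 0 < K) (hτ : 0 < τ) (hτT : τ ≤ T) (hρ : 1 ≤ ρ) (hρ4 : ρ ^ 4 = (τ : ℝ) / K)
    (hπ : IsSWRMOSS a ζ τ π) (x : Fin T → Fin K → ℝ) {j : Fin T → Fin K}
    (hj : ∀ t, ν.mean t (j t) = ν.bestMean t) :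
    ∑ t : Fin T, (ν.bestMean t - ν.mean t (π.arm x t))
      ≤ 2 * (τ * ν.variation) + 8 * (7 + 3 * ζ) * (17 * (T / ρ ^ 2))
        + ∑ t : Fin T, ∑ l ∈ Finset.range (level a T + 1),
          expCoeff a ζ (levelLimit a K τ l) (a ^ l) * lowerTerm a ζ τ π ν (j t) t l x
        + ∑ t : Fin T, ∑ l ∈ Finset.range (level a T + 1),
          upperCoeff a ρ q l * upperTerm a τ π ν (π.arm x t) t l x := by
  refine (Finset.sum_le_sum fun t _ =>
    loss_le hν ha hζ hq hqa hK hτ hρ hρ4 hπ t x (hj t)).trans ?_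
  simp only [Finset.sum_add_distrib, ← Finset.mul_sum]
  rw [Fin.sum_univ_eq_sum_range fun t => windowDrift ν τ t]
  gcongr
  · exact sum_windowDrift_le ν τ
  · exact sum_slack_arm_le hτT (one_pos.trans_le hρ) hρ4 x

/-- The constant of the regret bound, where `q ^ 4 = a`: the three summands come from the
confidence radii, from arms whose index is too low and from arms whose index is too high. -/
def regretConst (a ζ q : ℝ) : ℝ :=
  8 * (7 + 3 * ζ) * 17 + 2 * a / Real.log (1 + 2 * ζ / a) * (4 * (q / (q - 1)))
    + 48384 * a ^ 4 * (4 * (q / (q - 1)))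

theorem regretConst_pos (ha : 0 < a) (hζ : 0 < ζ) (hq : 1 < q) : 0 < regretConst a ζ q := by
  have := sub_pos.2 hq
  have hlog := log_one_add_pos ha hζ
  unfold regretConst
  positivity

theorem regret_le (hν : ν.HeavyTailed) (ha : 1 < a) (hζ : 0 < ζ)
    (hψ : 2 * a / ζ ≤ psi (2 * ζ / a)) (hq : 1 < q) (hqa : q ^ 4 = a) (hK : 0 < K) (hτ : 0 < τ)
    (hτT : τ ≤ T) (hρ : 1 ≤ ρ) (hρ4 : ρ ^ 4 = (τ : ℝ) / K) (hπ : IsSWRMOSS a ζ τ π) :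
    π.regret ν ≤ 2 * (τ * ν.variation) + regretConst a ζ q * (T / ρ ^ 2) := by
  choose j hj using ν.exists_mean_eq_bestMean hK
  have hρ0 : 0 < ρ := one_pos.trans_le hρ
  have hlowerInt := integrable_sum_lowerTerm (ζ := ζ) (τ := τ) hπ.measurable hν ha j
    (level a T + 1)
  have hupperInt := integrable_sum_upperTerm_arm (ρ := ρ) (q := q) (τ := τ) hπ.measurable hν ha
    (level a T + 1)
  have hlower := (integral_sum_lowerTerm_le hπ.measurable hν ha hζ j (level a T + 1)).trans
    (mul_le_mul_of_nonneg_left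
      (sum_expCoeff_le ha hζ hψ hq hqa hK hτ hρ0 hρ4 (level a T + 1)) T.cast_nonneg)
  have hupper := integral_sum_upperTerm_arm_le (τ := τ) hπ.measurable hν ha hq hqa hρ0
    (level a T + 1)
  have hloss := integral_mono (integrable_sum_loss hπ.measurable ν)
    (((integrable_const _).add hlowerInt).add hupperInt) fun x =>
      sum_loss_le hν ha hζ (one_pos.trans hq) hqa hK hτ hτT hρ hρ4 hπ x hj
  rw [integral_add' ((integrable_const _).add hlowerInt) hupperInt,
    integral_add' (integrable_const _) hlowerInt, integral_const, probReal_univ, one_smul] at hloss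
  rw [regret_eq_integral_sum_loss hπ.measurable hν]
  calc ∫ x, ∑ t : Fin T, (ν.bestMean t - ν.mean t (π.arm x t)) ∂ν.rewardLaw
      ≤ 2 * (τ * ν.variation) + 8 * (7 + 3 * ζ) * (17 * (T / ρ ^ 2))
        + T * (2 * a / Real.log (1 + 2 * ζ / a) * (4 * (q / (q - 1))) / ρ ^ 2)
        + 48384 * a ^ 4 * (4 * (q / (q - 1))) * (T / ρ ^ 2) :=
        hloss.trans (add_le_add (add_le_add_right hlower _) hupper)
    _ = 2 * (τ * ν.variation) + regretConst a ζ q * (T / ρ ^ 2) := by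
        unfold regretConst
        ring

theorem rpow_third_mul_rpow_two_thirds_pow_three {y z : ℝ} (hy : 0 ≤ y) (hz : 0 ≤ z) :
    (y ^ (1 / 3 : ℝ) * z ^ (2 / 3 : ℝ)) ^ 3 = y * z ^ 2 := by
  rw [mul_pow, ← Real.rpow_mul_natCast hy, ← Real.rpow_mul_natCast hz, ← Real.rpow_natCast z 2]
  norm_num

/-- The real number whose ceiling is the window length. -/
def windowScale (K T : ℕ) (V : ℝ) : ℝ := (K : ℝ) ^ (1 / 3 : ℝ) * ((T : ℝ) / V) ^ (2 / 3 : ℝ)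

/-- The rate at which the worst-case regret grows. -/
def regretRate (K T : ℕ) (V : ℝ) : ℝ := ((K : ℝ) * V) ^ (1 / 3 : ℝ) * (T : ℝ) ^ (2 / 3 : ℝ)

theorem regretRate_nonneg (hV : 0 < V) : 0 ≤ regretRate K T V := by
  unfold regretRate
  positivity

theorem windowScale_nonneg (hV : 0 < V) : 0 ≤ windowScale K T V := by
  unfold windowScale
  positivity

theorem windowScale_pow_three (hV : 0 < V) :
    windowScale K T V ^ 3 = K * (T / V) ^ 2 :=
  rpow_third_mul_rpow_two_thirds_pow_three K.cast_nonneg (by positivity)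

theorem regretRate_pow_three (hV : 0 < V) : regretRate K T V ^ 3 = K * V * T ^ 2 :=
  rpow_third_mul_rpow_two_thirds_pow_three (by positivity) T.cast_nonneg

theorem windowScale_mul_eq_regretRate (hV : 0 < V) : windowScale K T V * V = regretRate K T V := by
  refine (pow_left_inj₀ (mul_nonneg (windowScale_nonneg hV) hV.le) (regretRate_nonneg hV)
    three_ne_zero).1 ?_
  rw [mul_pow, windowScale_pow_three hV, regretRate_pow_three hV]
  field_simp

theorem windowScale_mul_regretRate_sq (hV : 0 < V) :
    windowScale K T V * regretRate K T V ^ 2 = K * T ^ 2 := by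
  refine (pow_left_inj₀ (mul_nonneg (windowScale_nonneg hV) (sq_nonneg _)) (by positivity)
    three_ne_zero).1 ?_
  calc _ = windowScale K T V ^ 3 * (regretRate K T V ^ 3) ^ 2 := by ring
    _ = _ := by
        rw [windowScale_pow_three hV, regretRate_pow_three hV]
        field_simp

theorem le_regretRate_of_windowScale_le (hV : 0 < V) (hK : 0 < K) (hw : windowScale K T V ≤ K) :
    T ≤ regretRate K T V := by
  refine (sq_le_sq₀ T.cast_nonneg (regretRate_nonneg hV)).1
    (le_of_mul_le_mul_left ?_ (Nat.cast_pos.2 hK : (0 : ℝ) < K))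
  exact (windowScale_mul_regretRate_sq hV).ge.trans (mul_le_mul_of_nonneg_right hw (sq_nonneg _))

theorem div_sq_le_regretRate (hV : 0 < V) (hK : 0 < K) (hτ : windowScale K T V ≤ τ) (hρ : 0 < ρ)
    (hρ4 : ρ ^ 4 = (τ : ℝ) / K) : T / ρ ^ 2 ≤ regretRate K T V := by
  have hK' : (0 : ℝ) < K := Nat.cast_pos.2 hK
  rw [div_le_iff₀ (by positivity)]
  have hrate := regretRate_nonneg (K := K) (T := T) hV
  refine (sq_le_sq₀ T.cast_nonneg (by positivity)).1 (le_of_mul_le_mul_left ?_ hK')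
  calc (K : ℝ) * T ^ 2 = windowScale K T V * regretRate K T V ^ 2 :=
        (windowScale_mul_regretRate_sq hV).symm
    _ ≤ τ * regretRate K T V ^ 2 := by gcongr
    _ = K * ρ ^ 4 * regretRate K T V ^ 2 := by rw [hρ4, mul_div_cancel₀ _ hK'.ne']
    _ = K * (regretRate K T V * ρ ^ 2) ^ 2 := by ring

theorem windowLength_le_two_mul (hw : 1 ≤ windowScale K T V) :
    (windowLength K T V : ℝ) ≤ 2 * windowScale K T V := by
  have hceil : (windowLength K T V : ℝ) < windowScale K T V + 1 :=
    Nat.ceil_lt_add_one (zero_le_one.trans hw)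
  linarith

theorem exists_one_le_pow_four_eq {y : ℝ} (hy : 1 ≤ y) : ∃ r : ℝ, 1 ≤ r ∧ r ^ 4 = y :=
  ⟨y ^ ((4 : ℕ) : ℝ)⁻¹, Real.one_le_rpow hy (by norm_num),
    Real.rpow_inv_natCast_pow (zero_le_one.trans hy) four_ne_zero⟩

theorem regret_le_regretRate (hν : ν.HeavyTailed) (hV : 0 < V) (hvar : ν.variation ≤ V)
    (ha : 1 < a) (hζ : 0 < ζ) (hψ : 2 * a / ζ ≤ psi (2 * ζ / a)) (hq : 1 < q) (hqa : q ^ 4 = a)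
    (hK : 0 < K) (hT : windowLength K T V ≤ T) (hπ : IsSWRMOSS a ζ (windowLength K T V) π) :
    π.regret ν ≤ (4 + regretConst a ζ q) * regretRate K T V := by
  have hconst := regretConst_pos (one_pos.trans ha) hζ hq
  have := regretRate_nonneg (K := K) (T := T) hV
  rcases le_total (windowScale K T V) K with hw | hw
  · calc π.regret ν ≤ 2 * T := regret_le_two_mul hπ.measurable hν hK
      _ ≤ (4 + regretConst a ζ q) * regretRate K T V := by
          gcongr
          · linarith
          · exact le_regretRate_of_windowScale_le hV hK hw
  · have hK1 : (1 : ℝ) ≤ K := Nat.one_le_cast.2 hK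
    have hscale : windowScale K T V ≤ windowLength K T V := Nat.le_ceil _
    have hτ : 0 < windowLength K T V :=
      Nat.cast_pos.1 (one_pos.trans_le (hK1.trans (hw.trans hscale)))
    obtain ⟨ρ, hρ, hρ4⟩ := exists_one_le_pow_four_eq
      ((one_le_div (one_pos.trans_le hK1)).2 (hw.trans hscale))
    have hdrift : windowLength K T V * ν.variation ≤ 2 * regretRate K T V := by
      calc windowLength K T V * ν.variation ≤ 2 * windowScale K T V * V :=
            (mul_le_mul_of_nonneg_left hvar (Nat.cast_nonneg _)).trans
              (mul_le_mul_of_nonneg_right (windowLength_le_two_mul (hK1.trans hw)) hV.le)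
        _ = 2 * regretRate K T V := by rw [mul_assoc, windowScale_mul_eq_regretRate hV]
    calc π.regret ν ≤ 2 * (windowLength K T V * ν.variation)
          + regretConst a ζ q * (T / ρ ^ 2) :=
          regret_le hν ha hζ hψ hq hqa hK hτ hT hρ hρ4 hπ
      _ ≤ 2 * (2 * regretRate K T V) + regretConst a ζ q * regretRate K T V := by
          gcongr
          exact div_sq_le_regretRate hV hK hscale (one_pos.trans_le hρ) hρ4
      _ = _ := by ring

end RegretBound

end SWRMOSS

end

open SWRMOSS

theorem theorem5 (a ζ : ℝ) (ha : 1 < a) (hζ : 0 < ζ)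
    (hψ : 2 * a / ζ ≤ SWRMOSS.psi (2 * ζ / a)) :
    ∃ C : ℝ, 0 < C ∧ ∀ (K T : ℕ) (V : ℝ), 0 < K → 0 < V →
      SWRMOSS.windowLength K T V ≤ T →
      ∀ π : SWRMOSS.Policy K, SWRMOSS.IsSWRMOSS a ζ (SWRMOSS.windowLength K T V) π →
        π.worstCaseRegret T V ≤
          ((C * ((K : ℝ) * V) ^ (1 / 3 : ℝ) * (T : ℝ) ^ (2 / 3 : ℝ) : ℝ) : EReal) := by
  obtain ⟨q, hq0, hqa⟩ := exists_one_le_pow_four_eq ha.le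
  have hq : 1 < q := hq0.lt_of_ne fun h => ha.ne (by rw [← hqa, ← h, one_pow])
  have hconst := regretConst_pos (one_pos.trans ha) hζ hq
  refine ⟨4 + regretConst a ζ q, by linarith, fun K T V hK hV hT π hπ =>
    iSup₂_le fun ν hν => EReal.coe_le_coe_iff.2 ?_⟩
  rw [mul_assoc]
  exact regret_le_regretRate hν.1 hV hν.2 ha hζ hψ hq hqa hK hT hπ
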